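/- **Theorem.** Let $n\ge 1$ be odd. Let $\mathcal H_0$ be the completion of $C_c^\infty(\mathbb R^n)\times C_c^\infty(\mathbb R^n)$ (complex-valued functions) with respect to the energy norm $$\|(\phi,\psi)\|_{\mathcal H_0}^2=\int_{\mathbb R^n}\bigl(|\nabla\phi(z)|^2+|\psi(z)|^2\bigr)\,dz .$$ For $f\in C_c^\infty(\mathbb R^n)$ let $(Rf)(s,\theta)=\int_{\langle z,\theta\rangle=s}f(z)\,d\sigma(z)$, $s\in\mathbb R$, $\theta\in S^{n-1}$, be its Radon transform, where $d\sigma$ is surface measure on the hyperplane $\langle z,\theta\rangle=s$. For $\phi,\psi\in C_c^\infty(\mathbb R^n)$ define the Lax–Phillips transform $$\mathrm{LP}(\phi,\psi)(s,\theta)=\frac{1}{\sqrt2\,(2\pi)^{(n-1)/2}}\Bigl(\partial_s^{(n+1)/2}(R\phi)(s,\theta)-\partial_s^{(n-1)/2}(R\psi)(s,\theta)\Bigr).$$ (a) For all $\phi,\psi\in C_c^\infty(\mathbb R^n)$ the Cauchy problem $\partial_t^2u=\Delta u$, $(u,\partial_tu)|_{t=0}=(\phi,\psi)$, has exactly one solution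 $u\in C^\infty(\mathbb R\times\mathbb R^n)$ that is compactly supported in $z$ locally uniformly in $t$. For every $t\in\mathbb R$, the map $(\phi,\psi)\mapsto(u(t),\partial_tu(t))$ from $C_c^\infty(\mathbb R^n)\times C_c^\infty(\mathbb R^n)$ to itself extends by continuity to a map $U_0(t):\mathcal H_0\to\mathcal H_0$ (the free wave group). (b) $\mathrm{LP}$ extends to a unitary isomorphism $$\mathrm{LP}:\mathcal H_0\to L^2\bigl(\mathbb R;L^2(S^{n-1})\bigr),$$ where $S^{n-1}$ carries its surface measure (counting measure on $S^0=\{\pm1\}$ if $n=1$), and this extension is a translation representation of $U_0$: for all $t\in\mathbb R$ and $x\in\mathcal H_0$, $$\bigl(\mathrm{LP}\,U_0(t)x\bigr)(s)=\bigl(\mathrm{LP}\,x\bigr)(s-t)\quad\text{for almost every } s\in\mathbb R .$$ -/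

import Mathlib

open MeasureTheory Metric UniformSpace
open scoped Distributions ContDiff InnerProductSpace Laplacian

noncomputable section

namespace LaxPhillips

/-- Euclidean space `ℝⁿ`. -/
abbrev Space (n : ℕ) : Type := EuclideanSpace ℝ (Fin n)

/-- The unit sphere `S^{n-1}` in `ℝⁿ`. -/
abbrev Sph (n : ℕ) : Type := sphere (0 : Space n) 1

/-- Complex valued smooth compactly supported functions on `ℝⁿ`. -/
abbrev Test (n : ℕ) : Type := 𝓓((⊤ : TopologicalSpace.Opens (Space n)), ℂ)

/-- The partial derivative `∂f/∂zᵢ`. -/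
def partialD {n : ℕ} (i : Fin n) (f : Space n → ℂ) (z : Space n) : ℂ :=
  fderiv ℝ f z (EuclideanSpace.single i 1)

lemma partialD_continuous {n : ℕ} (i : Fin n) (f : Test n) : Continuous (partialD i f) :=
  (f.contDiff.continuous_fderiv (by simp)).clm_apply continuous_const

lemma partialD_hasCompactSupport {n : ℕ} (i : Fin n) (f : Test n) :
    HasCompactSupport (partialD i f) :=
  f.hasCompactSupport.fderiv_apply ℝ _

lemma partialD_add {n : ℕ} (i : Fin n) (f g : Test n) (z : Space n) :
    partialD i (f + g : Test n) z = partialD i f z + partialD i g z := by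
  have hf : DifferentiableAt ℝ f z := f.contDiff.differentiable (by simp) z
  have hg : DifferentiableAt ℝ g z := g.contDiff.differentiable (by simp) z
  have h : (⇑(f + g : Test n)) = (f : Space n → ℂ) + g := rfl
  simp [partialD, h, fderiv_add hf hg]

lemma partialD_smul {n : ℕ} (i : Fin n) (c : ℂ) (f : Test n) (z : Space n) :
    partialD i (c • f : Test n) z = c * partialD i f z := by
  have hf : DifferentiableAt ℝ f z := f.contDiff.differentiable (by simp) z
  have h : (⇑(c • f : Test n)) = c • (f : Space n → ℂ) := rfl
  simp [partialD, h, fderiv_const_smul hf c]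

/-- Cauchy data `(φ, ψ)` in `C_c^∞(ℝⁿ) × C_c^∞(ℝⁿ)`.  This is a type of its own because it carries
the energy norm and not the topology of the space of test functions. -/
def Data (n : ℕ) : Type := Test n × Test n

instance (n : ℕ) : AddCommGroup (Data n) := inferInstanceAs (AddCommGroup (Test n × Test n))

instance (n : ℕ) : Module ℂ (Data n) := inferInstanceAs (Module ℂ (Test n × Test n))

/-- The integrand of the energy pairing. -/
def energyDensity {n : ℕ} (d e : Data n) (z : Space n) : ℂ :=
  (∑ i, (starRingEnd ℂ) (partialD i d.1 z) * partialD i e.1 z)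
    + (starRingEnd ℂ) (d.2 z) * e.2 z

lemma energyDensity_integrable {n : ℕ} (d e : Data n) :
    Integrable (energyDensity d e) := by
  unfold energyDensity
  refine Integrable.add (integrable_finsetSum _ fun i _ => ?_) ?_
  · exact (((Complex.continuous_conj.comp (partialD_continuous i d.1)).mul
      (partialD_continuous i e.1)).integrable_of_hasCompactSupport
        (partialD_hasCompactSupport i e.1).mul_left)
  · exact (((Complex.continuous_conj.comp d.2.continuous).mul
      e.2.continuous).integrable_of_hasCompactSupport e.2.hasCompactSupport.mul_left)

lemma energyDensity_self {n : ℕ} (d : Data n) (z : Space n) :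
    energyDensity d d z = (((∑ i, ‖partialD i d.1 z‖ ^ 2) + ‖d.2 z‖ ^ 2 : ℝ) : ℂ) := by
  simp [energyDensity, Complex.conj_mul']

/-- The energy pairing `∫ (∇φ₁ · ∇φ₂ + ψ₁ ψ₂) dz`, conjugate linear in the first pair. -/
@[reducible] def energyCore (n : ℕ) : PreInnerProductSpace.Core ℂ (Data n) where
  inner d e := ∫ z, energyDensity d e z
  conj_inner_symm d e := by
    rw [← integral_conj]
    refine integral_congr_ae (.of_forall fun z => ?_)
    simp [energyDensity, mul_comm]
  re_inner_nonneg d := by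
    simp only [energyDensity_self]
    rw [integral_complex_ofReal]
    exact integral_nonneg fun z => by positivity
  add_left d e f := by
    rw [← integral_add (energyDensity_integrable d f) (energyDensity_integrable e f)]
    refine integral_congr_ae (.of_forall fun z => ?_)
    have h1 : (d + e).1 = d.1 + e.1 := rfl
    have h2 : (d + e).2 z = d.2 z + e.2 z := rfl
    simp only [energyDensity, h1, h2, partialD_add, map_add, add_mul, Finset.sum_add_distrib]
    ring
  smul_left d e c := by
    rw [← integral_const_mul]
    refine integral_congr_ae (.of_forall fun z => ?_)
    have h1 : (c • d).1 = c • d.1 := rfl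
    have h2 : (c • d).2 z = c * d.2 z := rfl
    simp only [energyDensity, h1, h2, partialD_smul, map_mul, mul_add, Finset.mul_sum, mul_assoc]

instance (n : ℕ) : SeminormedAddCommGroup (Data n) :=
  InnerProductSpace.Core.toSeminormedAddCommGroup (c := energyCore n)

instance (n : ℕ) : InnerProductSpace ℂ (Data n) := InnerProductSpace.ofCore (energyCore n)

/-- The norm is the square root of the energy `∫ (|∇φ|² + |ψ|²) dz`. -/
lemma data_norm_sq {n : ℕ} (d : Data n) :
    ‖d‖ ^ 2 = ∫ z, ((∑ i, ‖partialD i d.1 z‖ ^ 2) + ‖d.2 z‖ ^ 2) := by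
  have h : inner ℂ d d = ∫ z, energyDensity d d z := rfl
  rw [← inner_self_eq_norm_sq (𝕜 := ℂ), h]
  simp only [energyDensity_self]
  rw [integral_complex_ofReal]
  rfl

/-- The free energy space `H₀`: the completion of `C_c^∞ × C_c^∞` for the energy norm. -/
abbrev EnergySpace (n : ℕ) : Type := Completion (Data n)

/-- `u(t, z)` is a smooth solution of `∂ₜ² u = Δ u` on `ℝ × ℝⁿ`, compactly supported in `z`
locally uniformly in `t`. -/
structure IsFreeWave {n : ℕ} (u : ℝ → Space n → ℂ) : Prop where
  smooth : ContDiff ℝ ∞ (fun p : ℝ × Space n => u p.1 p.2)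
  support : ∀ T : ℝ, ∃ r : ℝ, ∀ t z, |t| ≤ T → r < ‖z‖ → u t z = 0
  wave : ∀ t z, iteratedDeriv 2 (fun τ => u τ z) t = Δ (u t) z

/-- `(u, ∂ₜ u)` at time `t` is the pair `d` of test functions. -/
def HasCauchyData {n : ℕ} (u : ℝ → Space n → ℂ) (t : ℝ) (d : Data n) : Prop :=
  ∀ z, u t z = d.1 z ∧ deriv (fun τ => u τ z) t = d.2 z

open Classical in
/-- The free wave evolution on test data: `(φ, ψ) ↦ (u, ∂ₜ u)(t)`, where `u` is the free wave with
`(u, ∂ₜ u)(0) = (φ, ψ)`. -/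
def waveOnData {n : ℕ} (t : ℝ) (d : Data n) : Data n :=
  if h : ∃ d' : Data n, ∃ u, IsFreeWave u ∧ HasCauchyData u 0 d ∧ HasCauchyData u t d'
  then h.choose else 0

/-- The free wave group `U₀(t)` on the energy space: the extension by continuity of the evolution
on test data. -/
def waveGroup {n : ℕ} (t : ℝ) : EnergySpace n → EnergySpace n :=
  Completion.map (waveOnData t)

/-- The Radon transform `(R f)(s, θ) = ∫_{⟨z, θ⟩ = s} f dσ`; `μHE[n - 1]` is the Hausdorff measure
normalised to be the Euclidean surface measure on hyperplanes. -/
def radon {n : ℕ} (f : Space n → ℂ) (s : ℝ) (θ : Sph n) : ℂ :=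
  ∫ z in {z : Space n | inner ℝ z (θ : Space n) = s}, f z ∂μHE[n - 1]

/-- The Lax–Phillips transform (for odd `n`) of test data `(φ, ψ)`:
`2^{-1/2} (2π)^{-(n-1)/2} (∂_s^{(n+1)/2} R φ - ∂_s^{(n-1)/2} R ψ)`. -/
def laxPhillips {n : ℕ} (d : Data n) (s : ℝ) (θ : Sph n) : ℂ :=
  ((√2 * (2 * Real.pi) ^ ((n - 1) / 2) : ℝ) : ℂ)⁻¹ *
    (iteratedDeriv ((n + 1) / 2) (fun σ => radon d.1 σ θ) s
      - iteratedDeriv ((n - 1) / 2) (fun σ => radon d.2 σ θ) s)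

/-- `L²(S^{n-1})` with respect to the surface measure. -/
abbrev SphL2 (n : ℕ) : Type := Lp ℂ 2 ((volume : Measure (Space n)).toSphere)

/-- `L²(ℝ; L²(S^{n-1}))`. -/
abbrev TransL2 (n : ℕ) : Type := Lp (SphL2 n) 2 (volume : Measure ℝ)

end LaxPhillips

end

open LaxPhillips

/-! On the Fourier side all three claims about the transform become pointwise identities. By the
slice theorem (`fourier_radon`) the one-dimensional Fourier transform of `s ↦ R f (s, θ)` at `σ` is
the Fourier transform of `f` at `σθ`. For odd `n` the transform of data `(φ, ψ)` therefore has the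
Fourier transform `lpHat`, which is `c⁻¹ (2πiσ)^((n-1)/2) (2πiσ φ̂(σθ) - ψ̂(σθ))`.

Isometry (`lintegral_lpHat`): the power of `σ` contributes exactly the polar Jacobian `|σ|^(n-1)`.
Each `ξ ≠ 0` is `σθ` for two pairs `(σ, θ)`, antipodal to each other, and the parallelogram law adds
the two contributions to `|2π|ξ| φ̂|² + |ψ̂|²`. Plancherel on the line and on `ℝⁿ` then gives the
energy.

Translation (`lpHat_of_hasCauchyData`): the combination `2πiσ φ̂ - ψ̂` is an eigenvector of the wave
propagator with eigenvalue `e^(-2πiσt)`. Since translations are isometric, so is the evolution on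
test data. This is what extends it to the completion.

Surjectivity (`dense_range_lpTransform`): an isometry on a complete space has closed range, so dense
range is enough. Schwartz data realise on the Fourier side every product of a radial profile
vanishing near `σ = 0` with a smooth function on the sphere (`exists_lpHat_eq`). Nothing nonzero is
orthogonal to these, and cutoffs approximate Schwartz data by test data in energy.

The Cauchy problem is solved by Fourier multipliers (`freeWave`). Joint smoothness comes from
writing the sine propagator as a Fourier transform over a solid cone (`sinePropagator_eq`).
Uniqueness and compact support come from a weighted energy estimate in a backward light cone
(`antitone_weighted_energy`). -/

noncomputable section

namespace LaxPhillips

/-! ### Integrals depending on time, with locally uniform compact support -/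

section ParametricIntegral

variable {E G : Type*} [NormedAddCommGroup E] [NormedSpace ℝ E]
  [NormedAddCommGroup G] [NormedSpace ℝ G]

/-- `F t` has compact support, locally uniformly in `t`. -/
def LocUnifCompactSupport (F : ℝ × E → G) : Prop :=
  ∀ T : ℝ, ∃ r : ℝ, ∀ t z, |t| ≤ T → r < ‖z‖ → F (t, z) = 0

lemma hasDerivAt_slice {F : ℝ × E → G} {t : ℝ} {x : E} (hF : DifferentiableAt ℝ F (t, x)) :
    HasDerivAt (fun τ => F (τ, x)) (fderiv ℝ F (t, x) (1, 0)) t :=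
  hF.hasFDerivAt.comp_hasDerivAt t ((hasDerivAt_id t).prodMk (hasDerivAt_const t x))

lemma hasFDerivAt_slice {F : ℝ × E → G} {t : ℝ} {x : E} (hF : DifferentiableAt ℝ F (t, x)) :
    HasFDerivAt (fun y => F (t, y))
      ((fderiv ℝ F (t, x)).comp (ContinuousLinearMap.inr ℝ ℝ E)) x :=
  hF.hasFDerivAt.comp x (hasFDerivAt_prodMk_right t x)

omit [NormedSpace ℝ E] [NormedSpace ℝ G] in
lemma LocUnifCompactSupport.hasCompactSupport [ProperSpace E] {F : ℝ × E → G}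
    (hs : LocUnifCompactSupport F) (t : ℝ) : HasCompactSupport (fun x => F (t, x)) := by
  obtain ⟨r, hr⟩ := hs |t|
  refine HasCompactSupport.of_support_subset_isCompact (isCompact_closedBall (0 : E) r) ?_
  intro x hx
  by_contra h
  exact hx (hr t x le_rfl (by simpa using h))

lemma LocUnifCompactSupport.fderiv_time {F : ℝ × E → G} (hF : Differentiable ℝ F)
    (hs : LocUnifCompactSupport F) : LocUnifCompactSupport (fun p => fderiv ℝ F p (1, 0)) := by
  intro T
  -- The time derivative sees neighbouring times, so the radius has to serve a slightly larger time
  -- interval.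
  obtain ⟨r, hr⟩ := hs (T + 1)
  refine ⟨r, fun t z ht hz => ?_⟩
  have h1 := hasDerivAt_slice (hF (t, z))
  have h2 : (fun τ => F (τ, z)) =ᶠ[nhds t] fun _ => 0 := by
    filter_upwards [Metric.ball_mem_nhds t one_pos] with τ hτ
    refine hr τ z ?_ hz
    rw [Metric.mem_ball, Real.dist_eq] at hτ
    have := abs_sub_abs_le_abs_sub τ t
    linarith
  exact h1.unique ((hasDerivAt_const t (0 : G)).congr_of_eventuallyEq h2)

lemma hasDerivAt_integral_slice [FiniteDimensional ℝ E] [MeasurableSpace E] [BorelSpace E]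
    (μ : Measure E) [IsFiniteMeasureOnCompacts μ]
    {F : ℝ × E → G} (hF : ContDiff ℝ 1 F) (hs : LocUnifCompactSupport F) (t : ℝ) :
    HasDerivAt (fun τ => ∫ x, F (τ, x) ∂μ) (∫ x, fderiv ℝ F (t, x) (1, 0) ∂μ) t := by
  have hd : Differentiable ℝ F := hF.differentiable (by simp)
  have hc : Continuous fun p => fderiv ℝ F p (1, 0) :=
    (hF.continuous_fderiv (by simp)).clm_apply continuous_const
  obtain ⟨r, hr⟩ := hs.fderiv_time hd (|t| + 1)
  obtain ⟨C, hC⟩ := ((isCompact_closedBall t 1).prod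
    (isCompact_closedBall (0 : E) r)).exists_bound_of_continuousOn hc.continuousOn
  refine (hasDerivAt_integral_of_dominated_loc_of_deriv_le (μ := μ)
    (F' := fun τ x => fderiv ℝ F (τ, x) (1, 0))
    (bound := (closedBall (0 : E) r).indicator fun _ => C) (Metric.ball_mem_nhds t one_pos)
    (Filter.Eventually.of_forall fun τ => ?_) ?_ ?_ ?_ ?_ ?_).2
  · exact ((hF.continuous.comp (Continuous.prodMk_right τ)).integrable_of_hasCompactSupport
      (hs.hasCompactSupport τ)).1
  · exact (hF.continuous.comp (Continuous.prodMk_right t)).integrable_of_hasCompactSupport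
      (hs.hasCompactSupport t)
  · exact ((hc.comp (Continuous.prodMk_right t)).integrable_of_hasCompactSupport
      ((hs.fderiv_time hd).hasCompactSupport t)).1
  · refine Filter.Eventually.of_forall fun x τ hτ => ?_
    by_cases hx : x ∈ closedBall (0 : E) r
    · rw [Set.indicator_of_mem hx]
      exact hC (τ, x) ⟨ball_subset_closedBall hτ, hx⟩
    · rw [Set.indicator_of_notMem hx, show fderiv ℝ F (τ, x) (1, 0) = 0 from
        hr τ x ?_ (by simpa using hx), norm_zero]
      rw [Metric.mem_ball, Real.dist_eq] at hτ
      have := abs_sub_abs_le_abs_sub τ t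
      linarith
  · exact (integrable_indicator_iff measurableSet_closedBall).2
      (integrableOn_const (isCompact_closedBall _ _).measure_lt_top.ne)
  · exact Filter.Eventually.of_forall fun x τ _ => hasDerivAt_slice (hd _)

lemma integral_fderiv_eq_zero [FiniteDimensional ℝ E] [MeasurableSpace E] [BorelSpace E]
    (μ : Measure E) [μ.IsAddHaarMeasure] {f : E → ℝ} (hf : ContDiff ℝ 1 f)
    (hs : HasCompactSupport f) (v : E) : ∫ x, fderiv ℝ f x v ∂μ = 0 := by
  have hc : Continuous fun x => fderiv ℝ f x v :=
    (hf.continuous_fderiv (by simp)).clm_apply continuous_const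
  have h := integral_mul_fderiv_eq_neg_fderiv_mul_of_integrable (μ := μ)
    (f := fun _ : E => (1 : ℝ)) (g := f) (v := v) (by simp)
    (by simpa using hc.integrable_of_hasCompactSupport (hs.fderiv_apply ℝ v))
    (by simpa using hf.continuous.integrable_of_hasCompactSupport hs)
    (fun _ _ => differentiableAt_const _) (fun _ _ => hf.differentiable (by simp) _)
  simpa using h

end ParametricIntegral

/-! ### The weighted energy inequality in a light cone -/

section Energy

variable {n : ℕ}

/-- The `i`-th spatial unit vector in space-time. -/
abbrev spaceDir (i : Fin n) : ℝ × Space n := (0, EuclideanSpace.single i 1)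

/-- The time unit vector in space-time. -/
abbrev timeDir (n : ℕ) : ℝ × Space n := (1, 0)

lemma two_le_infty : (2 : WithTop ℕ∞) ≤ ∞ :=
  WithTop.coe_le_coe.2 (le_top : (2 : ℕ∞) ≤ ⊤)

lemma contDiff_fderiv_const {E G : Type*} [NormedAddCommGroup E] [NormedSpace ℝ E]
    [NormedAddCommGroup G] [NormedSpace ℝ G] {f : E → G} (hf : ContDiff ℝ ∞ f) (v : E) :
    ContDiff ℝ ∞ fun p => fderiv ℝ f p v :=
  (hf.fderiv_right (m := ∞) (by simp)).clm_apply contDiff_const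

lemma fderiv_fderiv_comm {E G : Type*} [NormedAddCommGroup E] [NormedSpace ℝ E]
    [NormedAddCommGroup G] [NormedSpace ℝ G] {f : E → G} (hf : ContDiff ℝ ∞ f) (v w p : E) :
    fderiv ℝ (fun q => fderiv ℝ f q v) p w = fderiv ℝ (fun q => fderiv ℝ f q w) p v := by
  have hd : DifferentiableAt ℝ (fderiv ℝ f) p :=
    ((hf.fderiv_right (m := ∞) (by simp)).differentiable (by simp)) p
  have h (v w : E) : fderiv ℝ (fun q => fderiv ℝ f q v) p w = fderiv ℝ (fderiv ℝ f) p w v := by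
    rw [fderiv_clm_apply hd (differentiableAt_const v)]
    simp
  rw [h, h]
  exact (hf.contDiffAt.isSymmSndFDerivAt (by simpa using two_le_infty)).eq _ _

/-- A weight whose level sets are space-like: the weighted energy of a wave decreases. -/
structure IsSpacelikeWeight (W : ℝ × Space n → ℝ) : Prop where
  smooth : ContDiff ℝ ∞ W
  nonneg : ∀ p, 0 ≤ W p
  support : LocUnifCompactSupport W
  deriv_time_nonpos : ∀ p, fderiv ℝ W p (timeDir n) ≤ 0
  sum_sq_le : ∀ p, ∑ i, fderiv ℝ W p (spaceDir i) ^ 2 ≤ fderiv ℝ W p (timeDir n) ^ 2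

/-- The energy density of a real function on space-time. -/
def realEnergy (U : ℝ × Space n → ℝ) (p : ℝ × Space n) : ℝ :=
  fderiv ℝ U p (timeDir n) ^ 2 + ∑ i, fderiv ℝ U p (spaceDir i) ^ 2

lemma contDiff_realEnergy {U : ℝ × Space n → ℝ} (hU : ContDiff ℝ ∞ U) :
    ContDiff ℝ ∞ (realEnergy U) :=
  ((contDiff_fderiv_const hU _).pow 2).add
    (ContDiff.sum fun _ _ => (contDiff_fderiv_const hU _).pow 2)

lemma realEnergy_nonneg (U : ℝ × Space n → ℝ) (p : ℝ × Space n) : 0 ≤ realEnergy U p := by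
  unfold realEnergy; positivity

/-- Cauchy–Schwarz gives `|v · b| ≤ |w| |b|`, and `2 |a| |b| ≤ a² + |b|²` does the rest. With `w`
and `v` the time and space derivatives of the weight, this is where space-like level sets enter. -/
lemma flux_le {ι : Type*} [Fintype ι] {w a : ℝ} {v b : ι → ℝ} (hw : w ≤ 0)
    (hv : ∑ i, v i ^ 2 ≤ w ^ 2) :
    w * (a ^ 2 + ∑ i, b i ^ 2) - 2 * ∑ i, v i * a * b i ≤ 0 := by
  have h1 : (∑ i, v i * b i) ^ 2 ≤ (∑ i, v i ^ 2) * ∑ i, b i ^ 2 :=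
    Finset.sum_mul_sq_le_sq_mul_sq _ _ _
  set B := ∑ i, b i ^ 2 with hB
  have hB0 : 0 ≤ B := by positivity
  have h2 : ∑ i, v i * a * b i = a * ∑ i, v i * b i := by
    rw [Finset.mul_sum]; exact Finset.sum_congr rfl fun i _ => by ring
  rw [h2]
  set S := ∑ i, v i * b i
  have h3 : (a * S) ^ 2 ≤ (-w * ((a ^ 2 + B) / 2)) ^ 2 := by
    have h4 : S ^ 2 ≤ w ^ 2 * B := h1.trans (by gcongr)
    have h5 : a ^ 2 * B ≤ ((a ^ 2 + B) / 2) ^ 2 := by nlinarith [sq_nonneg (a ^ 2 - B)]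
    calc (a * S) ^ 2 = a ^ 2 * S ^ 2 := by ring
      _ ≤ a ^ 2 * (w ^ 2 * B) := by gcongr
      _ = w ^ 2 * (a ^ 2 * B) := by ring
      _ ≤ w ^ 2 * ((a ^ 2 + B) / 2) ^ 2 := by gcongr
      _ = _ := by ring
  have h6 := abs_le_of_sq_le_sq h3 (by have : 0 ≤ -w := by linarith
                                       positivity)
  nlinarith [neg_abs_le (a * S)]

/-- For a wave `U` with energy density `e`, `∂ₜ e = 2 div (∂ₜU ∇U)`. Moving `W` under the divergence
leaves the cross term with `∇W`. -/
lemma fderiv_weight_energy {W U : ℝ × Space n → ℝ} (hW : ContDiff ℝ ∞ W) (hU : ContDiff ℝ ∞ U)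
    (hwave : ∀ p, fderiv ℝ (fun q => fderiv ℝ U q (timeDir n)) p (timeDir n) =
      ∑ i, fderiv ℝ (fun q => fderiv ℝ U q (spaceDir i)) p (spaceDir i)) (p : ℝ × Space n) :
    fderiv ℝ (fun q => W q * realEnergy U q) p (timeDir n) =
      (fderiv ℝ W p (timeDir n) * realEnergy U p
        - 2 * ∑ i, fderiv ℝ W p (spaceDir i) * fderiv ℝ U p (timeDir n) *
            fderiv ℝ U p (spaceDir i))
      + 2 * ∑ i, fderiv ℝ (fun q => W q * fderiv ℝ U q (timeDir n) *
          fderiv ℝ U q (spaceDir i)) p (spaceDir i) := by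
  have hWd : DifferentiableAt ℝ W p := hW.differentiable (by simp) p
  have hd (v : ℝ × Space n) : DifferentiableAt ℝ (fun q => fderiv ℝ U q v) p :=
    (contDiff_fderiv_const hU v).differentiable (by simp) p
  have h1 : HasFDerivAt (realEnergy U) ((2 * fderiv ℝ U p (timeDir n)) •
      fderiv ℝ (fun q => fderiv ℝ U q (timeDir n)) p + ∑ i, (2 * fderiv ℝ U p (spaceDir i)) •
      fderiv ℝ (fun q => fderiv ℝ U q (spaceDir i)) p) p := by
    have h (v : ℝ × Space n) : HasFDerivAt (fun q => fderiv ℝ U q v ^ 2)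
        ((2 * fderiv ℝ U p v) • fderiv ℝ (fun q => fderiv ℝ U q v) p) p := by
      simpa using (hd v).hasFDerivAt.pow 2
    exact (h _).add (HasFDerivAt.fun_sum fun i _ => h (spaceDir i))
  have h2 (i : Fin n) : fderiv ℝ (fun q => W q * fderiv ℝ U q (timeDir n) *
      fderiv ℝ U q (spaceDir i)) p (spaceDir i) =
      fderiv ℝ W p (spaceDir i) * fderiv ℝ U p (timeDir n) * fderiv ℝ U p (spaceDir i)
      + W p * (fderiv ℝ U p (spaceDir i) *
          fderiv ℝ (fun q => fderiv ℝ U q (spaceDir i)) p (timeDir n))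
      + W p * fderiv ℝ U p (timeDir n) *
          fderiv ℝ (fun q => fderiv ℝ U q (spaceDir i)) p (spaceDir i) := by
    rw [((hWd.hasFDerivAt.fun_mul (hd _).hasFDerivAt).fun_mul (hd _).hasFDerivAt).fderiv,
      fderiv_fderiv_comm hU (spaceDir i) (timeDir n)]
    simp only [add_apply, smul_apply, smul_eq_mul]
    ring
  rw [(hWd.hasFDerivAt.fun_mul h1).fderiv]
  simp only [h2, Finset.sum_add_distrib]
  simp only [add_apply, smul_apply, smul_eq_mul, sum_apply, hwave,
    ← Finset.mul_sum, mul_assoc]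
  ring

/-- Under the integral the divergence in `fderiv_weight_energy` disappears, and the remaining terms
are nonpositive by `flux_le`. Only `W` needs compact support, so the estimate is local in `U`. -/
lemma antitone_weighted_energy {W U : ℝ × Space n → ℝ} (hW : IsSpacelikeWeight W)
    (hU : ContDiff ℝ ∞ U)
    (hwave : ∀ p, fderiv ℝ (fun q => fderiv ℝ U q (timeDir n)) p (timeDir n) =
      ∑ i, fderiv ℝ (fun q => fderiv ℝ U q (spaceDir i)) p (spaceDir i)) :
    Antitone fun t => ∫ x, W (t, x) * realEnergy U (t, x) := by
  have hsupp {F : ℝ × Space n → ℝ} : LocUnifCompactSupport fun q => W q * F q := fun T => by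
    obtain ⟨r, hr⟩ := hW.support T
    exact ⟨r, fun t z ht hz => by simp [hr t z ht hz]⟩
  have hF : ContDiff ℝ ∞ fun q => W q * realEnergy U q := hW.smooth.mul (contDiff_realEnergy hU)
  have hder := hasDerivAt_integral_slice (volume : Measure (Space n))
    (hF.of_le (by simp)) hsupp
  refine antitone_of_hasDerivAt_nonpos hder fun t => ?_
  have hG (i : Fin n) : ContDiff ℝ ∞ fun q => W q * fderiv ℝ U q (timeDir n) *
      fderiv ℝ U q (spaceDir i) :=
    (hW.smooth.mul (contDiff_fderiv_const hU _)).mul (contDiff_fderiv_const hU _)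
  have hGs (i : Fin n) : LocUnifCompactSupport fun q => W q * fderiv ℝ U q (timeDir n) *
      fderiv ℝ U q (spaceDir i) := by
    simp only [mul_assoc]; exact hsupp
  have hslice (i : Fin n) (x : Space n) : fderiv ℝ (fun q => W q * fderiv ℝ U q (timeDir n) *
      fderiv ℝ U q (spaceDir i)) (t, x) (spaceDir i) =
      fderiv ℝ (fun y => W (t, y) * fderiv ℝ U (t, y) (timeDir n) *
        fderiv ℝ U (t, y) (spaceDir i)) x (EuclideanSpace.single i 1) := by
    rw [(hasFDerivAt_slice ((hG i).differentiable (by simp) (t, x))).fderiv]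
    rfl
  have hGt (i : Fin n) : ContDiff ℝ 1 fun y => W (t, y) * fderiv ℝ U (t, y) (timeDir n) *
        fderiv ℝ U (t, y) (spaceDir i) :=
    ((hG i).comp (contDiff_prodMk_right t)).of_le (by simp)
  have hint (i : Fin n) : Integrable fun x => fderiv ℝ (fun q => W q * fderiv ℝ U q (timeDir n) *
      fderiv ℝ U q (spaceDir i)) (t, x) (spaceDir i) := by
    simp only [hslice]
    exact (((hGt i).continuous_fderiv (by simp)).clm_apply
      continuous_const).integrable_of_hasCompactSupport
        (((hGs i).hasCompactSupport t).fderiv_apply ℝ _)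
  have hzero : ∫ x, 2 * ∑ i, fderiv ℝ (fun q => W q * fderiv ℝ U q (timeDir n) *
      fderiv ℝ U q (spaceDir i)) (t, x) (spaceDir i) = 0 := by
    rw [integral_const_mul, integral_finsetSum _ fun i _ => hint i]
    simp only [hslice]
    rw [Finset.sum_eq_zero fun i _ =>
      integral_fderiv_eq_zero volume (hGt i) ((hGs i).hasCompactSupport t) _, mul_zero]
  have hFint : Integrable fun x =>
      fderiv ℝ (fun q => W q * realEnergy U q) (t, x) (timeDir n) :=
    (((contDiff_fderiv_const hF _).continuous.comp
      (Continuous.prodMk_right t))).integrable_of_hasCompactSupport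
      ((hsupp.fderiv_time (hF.differentiable (by simp))).hasCompactSupport t)
  calc ∫ x, fderiv ℝ (fun q => W q * realEnergy U q) (t, x) (timeDir n)
      ≤ ∫ x, 2 * ∑ i, fderiv ℝ (fun q => W q * fderiv ℝ U q (timeDir n) *
          fderiv ℝ U q (spaceDir i)) (t, x) (spaceDir i) := by
        refine integral_mono hFint ((integrable_finsetSum _ fun i _ => hint i).const_mul _)
          fun x => ?_
        beta_reduce
        rw [fderiv_weight_energy hW.smooth hU hwave]
        have := flux_le (a := fderiv ℝ U (t, x) (timeDir n))
          (b := fun i => fderiv ℝ U (t, x) (spaceDir i)) (hW.deriv_time_nonpos (t, x))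
          (hW.sum_sq_le (t, x))
        unfold realEnergy
        linarith
    _ = 0 := hzero
    _ ≤ 0 := le_rfl

/-- The space-like weight `χ(ρ - t - √(ε² + |x - x₀|²))`, with support in the backward light cone
with base `ball x₀ ρ`. -/
def coneWeight (x₀ : Space n) (ρ ε : ℝ) (p : ℝ × Space n) : ℝ :=
  expNegInvGlue (ρ - (p.1 + √(ε ^ 2 + ‖p.2 - x₀‖ ^ 2)))

lemma le_sqrt_sq_add (ε : ℝ) (x : Space n) : ‖x‖ ≤ √(ε ^ 2 + ‖x‖ ^ 2) :=
  Real.le_sqrt_of_sq_le (by nlinarith [sq_nonneg ε])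

/-- The regularised distance `√(ε² + |x - x₀|²)` is smooth at `x₀` too, and its gradient has length
at most one, which is the space-like condition. -/
lemma isSpacelikeWeight_coneWeight (x₀ : Space n) (ρ : ℝ) {ε : ℝ} (hε : 0 < ε) :
    IsSpacelikeWeight (coneWeight x₀ ρ ε) := by
  have hpos (p : ℝ × Space n) : 0 < ε ^ 2 + ‖p.2 - x₀‖ ^ 2 := by positivity
  have hsm : ContDiff ℝ ∞ (coneWeight x₀ ρ ε) := by
    refine expNegInvGlue.contDiff.comp (contDiff_const.sub (contDiff_fst.add ?_))
    exact ContDiff.sqrt (contDiff_const.add ((contDiff_snd.sub contDiff_const).norm_sq ℝ))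
      fun p => (hpos p).ne'
  have hder (p v : ℝ × Space n) : fderiv ℝ (coneWeight x₀ ρ ε) p v =
      -deriv expNegInvGlue (ρ - (p.1 + √(ε ^ 2 + ‖p.2 - x₀‖ ^ 2))) *
        (v.1 + inner ℝ (p.2 - x₀) v.2 / √(ε ^ 2 + ‖p.2 - x₀‖ ^ 2)) := by
    have h1 : HasFDerivAt (fun q : ℝ × Space n => ‖q.2 - x₀‖ ^ 2) (2 • (innerSL ℝ (p.2 - x₀)).comp
        (ContinuousLinearMap.snd ℝ ℝ (Space n))) p := by
      have := ((hasFDerivAt_id (𝕜 := ℝ) p).snd.sub_const x₀).norm_sq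
      exact this
    have h2 := ((h1.const_add (ε ^ 2)).sqrt (hpos p).ne')
    have h3 := ((hasFDerivAt_id (𝕜 := ℝ) p).fst.add h2).const_sub ρ
    have h4 := ((expNegInvGlue.contDiff (n := 1)).differentiable (by simp)
      (ρ - (p.1 + √(ε ^ 2 + ‖p.2 - x₀‖ ^ 2)))).hasDerivAt.comp_hasFDerivAt p h3
    have h5 : fderiv ℝ (coneWeight x₀ ρ ε) p = _ := h4.fderiv
    rw [h5]
    simp [inner_sub_left]
    ring
  have hχ (y : ℝ) : 0 ≤ deriv expNegInvGlue y := expNegInvGlue.monotone.deriv_nonneg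
  refine ⟨hsm, fun p => expNegInvGlue.nonneg _, fun T => ⟨‖x₀‖ + ρ + T, fun t z ht hz => ?_⟩,
    fun p => ?_, fun p => ?_⟩
  · refine expNegInvGlue.zero_of_nonpos ?_
    have h1 := le_sqrt_sq_add ε (z - x₀)
    have h2 := norm_sub_norm_le z x₀
    have h3 := neg_abs_le t
    dsimp only
    linarith
  · rw [hder]
    simpa using hχ _
  · simp only [hder, inner_zero_right, zero_div, add_zero, zero_add, mul_pow, mul_one,
      EuclideanSpace.inner_single_right, one_mul, conj_trivial, div_pow, ← Finset.mul_sum,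
      ← Finset.sum_div, ← EuclideanSpace.real_norm_sq_eq]
    rw [Real.sq_sqrt (hpos p).le]
    have h1 : ‖p.2 - x₀‖ ^ 2 / (ε ^ 2 + ‖p.2 - x₀‖ ^ 2) ≤ 1 :=
      (div_le_one (hpos p)).2 (by nlinarith [sq_nonneg ε])
    exact mul_le_of_le_one_right (sq_nonneg _) h1

/-- The weighted energy vanishes at time zero and cannot grow, so its continuous nonnegative
integrand vanishes identically at time `t`. At `x₀` the weight is positive, hence the energy density
is zero there. -/
lemma fderiv_time_eq_zero_of_data_eq_zero {U : ℝ × Space n → ℝ} (hU : ContDiff ℝ ∞ U)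
    (hwave : ∀ p, fderiv ℝ (fun q => fderiv ℝ U q (timeDir n)) p (timeDir n) =
      ∑ i, fderiv ℝ (fun q => fderiv ℝ U q (spaceDir i)) p (spaceDir i))
    {x₀ : Space n} {ρ : ℝ} (h0 : ∀ x ∈ Metric.ball x₀ ρ, U (0, x) = 0)
    (h1 : ∀ x ∈ Metric.ball x₀ ρ, fderiv ℝ U (0, x) (timeDir n) = 0) {t : ℝ} (ht : 0 ≤ t) (htρ : t < ρ) :
    fderiv ℝ U (t, x₀) (timeDir n) = 0 := by
  -- Any `0 < ε < ρ - t` would do: it keeps the weight positive at the point `(t, x₀)`.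
  have hε : 0 < (ρ - t) / 2 := by linarith
  set ε := (ρ - t) / 2 with hεdef
  have hW := isSpacelikeWeight_coneWeight x₀ ρ hε
  have hcont : Continuous fun q => coneWeight x₀ ρ ε q * realEnergy U q :=
    hW.smooth.continuous.mul (contDiff_realEnergy hU).continuous
  have hanti := antitone_weighted_energy hW hU hwave ht
  have hz : ∫ x, coneWeight x₀ ρ ε (0, x) * realEnergy U (0, x) = 0 := by
    refine integral_eq_zero_of_ae (.of_forall fun x => ?_)
    change coneWeight x₀ ρ ε (0, x) * realEnergy U (0, x) = 0
    by_cases hx : x ∈ Metric.ball x₀ ρ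
    · have hsp (i : Fin n) : fderiv ℝ U (0, x) (spaceDir i) = 0 := by
        have h2 := hasFDerivAt_slice (hU.differentiable (by simp) ((0 : ℝ), x))
        have h3 : (fun y => U (0, y)) =ᶠ[nhds x] fun _ => 0 := by
          filter_upwards [isOpen_ball.mem_nhds hx] with y hy using h0 y hy
        have h4 := h2.unique ((hasFDerivAt_const (0 : ℝ) x).congr_of_eventuallyEq h3)
        exact congrArg (fun L => L (EuclideanSpace.single i 1)) h4
      simp [realEnergy, hsp, h1 x hx]
    · rw [coneWeight, expNegInvGlue.zero_of_nonpos, zero_mul]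
      have h2 := le_sqrt_sq_add ε (x - x₀)
      rw [mem_ball, dist_eq_norm, not_lt] at hx
      dsimp only
      linarith
  have hnn (x : Space n) : 0 ≤ coneWeight x₀ ρ ε (t, x) * realEnergy U (t, x) :=
    mul_nonneg (hW.nonneg _) (realEnergy_nonneg _ _)
  have hz' : ∫ x, coneWeight x₀ ρ ε (t, x) * realEnergy U (t, x) = 0 :=
    le_antisymm (hanti.trans hz.le) (integral_nonneg hnn)
  have hct : Continuous fun x => coneWeight x₀ ρ ε (t, x) * realEnergy U (t, x) :=
    hcont.comp (Continuous.prodMk_right t)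
  have hsupp : HasCompactSupport fun x => coneWeight x₀ ρ ε (t, x) * realEnergy U (t, x) :=
    (hW.support.hasCompactSupport t).mul_right
  rw [integral_eq_zero_iff_of_nonneg hnn (hct.integrable_of_hasCompactSupport hsupp)] at hz'
  have hz'' := congrFun ((hct.ae_eq_iff_eq volume continuous_zero).1 hz') x₀
  have hpos : 0 < coneWeight x₀ ρ ε (t, x₀) := by
    refine expNegInvGlue.pos_of_pos ?_
    simp only [sub_self, norm_zero]
    rw [zero_pow two_ne_zero, add_zero, Real.sqrt_sq hε.le]
    linarith
  have he : realEnergy U (t, x₀) = 0 := (mul_eq_zero.1 hz'').resolve_left hpos.ne'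
  unfold realEnergy at he
  have h5 : 0 ≤ ∑ i, fderiv ℝ U (t, x₀) (spaceDir i) ^ 2 := by positivity
  exact pow_eq_zero_iff two_ne_zero |>.1 (by nlinarith [sq_nonneg (fderiv ℝ U (t, x₀) (timeDir n))])

lemma eq_zero_of_data_eq_zero {U : ℝ × Space n → ℝ} (hU : ContDiff ℝ ∞ U)
    (hwave : ∀ p, fderiv ℝ (fun q => fderiv ℝ U q (timeDir n)) p (timeDir n) =
      ∑ i, fderiv ℝ (fun q => fderiv ℝ U q (spaceDir i)) p (spaceDir i))
    {x₀ : Space n} {ρ : ℝ} (h0 : ∀ x ∈ Metric.ball x₀ ρ, U (0, x) = 0)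
    (h1 : ∀ x ∈ Metric.ball x₀ ρ, fderiv ℝ U (0, x) (timeDir n) = 0) {t : ℝ} (ht : 0 ≤ t) (htρ : t < ρ) :
    U (t, x₀) = 0 := by
  have hd (τ : ℝ) := hasDerivAt_slice (hU.differentiable (by simp) (τ, x₀))
  have := constant_of_has_deriv_right_zero (f := fun τ => U (τ, x₀)) (a := 0) (b := t)
    (fun τ _ => (hd τ).continuousAt.continuousWithinAt) (fun τ hτ => by
      rw [← fderiv_time_eq_zero_of_data_eq_zero hU hwave h0 h1 hτ.1 (hτ.2.trans htρ)]
      exact (hd τ).hasDerivWithinAt) t ⟨ht, le_rfl⟩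
  rw [this]
  exact h0 x₀ (mem_ball_self (ht.trans_lt htρ))

end Energy

/-! ### Uniqueness and finite speed of propagation -/

section FiniteSpeed

variable {n : ℕ}

lemma iteratedDeriv_two_slice {G : Type*} [NormedAddCommGroup G] [NormedSpace ℝ G]
    {F : ℝ × Space n → G} (hF : ContDiff ℝ ∞ F) (t : ℝ) (z : Space n) :
    iteratedDeriv 2 (fun τ => F (τ, z)) t =
      fderiv ℝ (fun q => fderiv ℝ F q (timeDir n)) (t, z) (timeDir n) := by
  have h1 : deriv (fun τ => F (τ, z)) = fun τ => fderiv ℝ F (τ, z) (timeDir n) :=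
    funext fun τ => (hasDerivAt_slice (hF.differentiable (by simp) (τ, z))).deriv
  rw [iteratedDeriv_succ, iteratedDeriv_one, h1]
  exact (hasDerivAt_slice ((contDiff_fderiv_const hF _).differentiable (by simp) (t, z))).deriv

lemma laplacian_slice {F : ℝ × Space n → ℂ} (hF : ContDiff ℝ ∞ F) (t : ℝ) (z : Space n) :
    (Δ fun y => F (t, y)) z =
      ∑ i, fderiv ℝ (fun q => fderiv ℝ F q (spaceDir i)) (t, z) (spaceDir i) := by
  have h1 : fderiv ℝ (fun y => F (t, y)) =
      fun y => (fderiv ℝ F (t, y)).comp (ContinuousLinearMap.inr ℝ ℝ (Space n)) :=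
    funext fun y => (hasFDerivAt_slice (hF.differentiable (by simp) (t, y))).fderiv
  rw [InnerProductSpace.laplacian_eq_iteratedFDeriv_orthonormalBasis _
    (EuclideanSpace.basisFun (Fin n) ℝ)]
  refine Finset.sum_congr rfl fun i _ => ?_
  rw [iteratedFDeriv_two_apply]
  have h2 := (hasFDerivAt_slice ((contDiff_fderiv_const hF (spaceDir i)).differentiable
    (by simp) (t, z))).fderiv
  have h3 : DifferentiableAt ℝ (fderiv ℝ fun y => F (t, y)) z :=
    (((hF.comp (contDiff_prodMk_right t)).fderiv_right (m := ∞) (by simp)).differentiable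
      (by simp)) z
  have h4 := congrArg (fun L => L (EuclideanSpace.single i (1 : ℝ))) h2
  simp only [ContinuousLinearMap.comp_apply, ContinuousLinearMap.inr_apply] at h4
  rw [← h4]
  have h5 : (fun y => fderiv ℝ F (t, y) (spaceDir i)) =
      fun y => fderiv ℝ (fun y => F (t, y)) y (EuclideanSpace.single i 1) := by rw [h1]; rfl
  rw [h5, fderiv_clm_apply h3 (differentiableAt_const _)]
  simp

/-- The free wave equation for a smooth function on space-time. -/
def IsWave (F : ℝ × Space n → ℂ) : Prop :=
  ∀ p, fderiv ℝ (fun q => fderiv ℝ F q (timeDir n)) p (timeDir n) =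
    ∑ i, fderiv ℝ (fun q => fderiv ℝ F q (spaceDir i)) p (spaceDir i)

lemma isWave_iff {u : ℝ → Space n → ℂ} (hu : ContDiff ℝ ∞ fun p : ℝ × Space n => u p.1 p.2) :
    IsWave (fun p => u p.1 p.2) ↔ ∀ t z, iteratedDeriv 2 (fun τ => u τ z) t = (Δ (u t)) z := by
  have h1 (t : ℝ) (z : Space n) := iteratedDeriv_two_slice hu t z
  have h2 (t : ℝ) (z : Space n) := laplacian_slice hu t z
  dsimp only at h1 h2
  constructor
  · intro h t z
    rw [h1, h (t, z), ← h2]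
  · rintro h ⟨t, z⟩
    rw [← h1, h t z, ← h2]

lemma fderiv_clm_comp_apply {F : ℝ × Space n → ℂ} (hF : ContDiff ℝ ∞ F) (L : ℂ →L[ℝ] ℝ)
    (v : ℝ × Space n) :
    (fun p => fderiv ℝ (fun q => L (F q)) p v) = fun p => L (fderiv ℝ F p v) := by
  funext p
  rw [show fderiv ℝ (fun q => L (F q)) p = _ from
    (L.hasFDerivAt.comp p (hF.differentiable (by simp) p).hasFDerivAt).fderiv]
  rfl

lemma IsWave.eq_zero_of_nonneg {F : ℝ × Space n → ℂ} (hF : ContDiff ℝ ∞ F) (hw : IsWave F)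
    {x₀ : Space n} {ρ : ℝ} (h0 : ∀ x ∈ Metric.ball x₀ ρ, F (0, x) = 0)
    (h1 : ∀ x ∈ Metric.ball x₀ ρ, fderiv ℝ F (0, x) (timeDir n) = 0) {t : ℝ} (ht : 0 ≤ t)
    (htρ : t < ρ) : F (t, x₀) = 0 := by
  -- The energy estimate is for real waves; it is applied to the real and the imaginary part.
  have key (L : ℂ →L[ℝ] ℝ) : L (F (t, x₀)) = 0 := by
    refine eq_zero_of_data_eq_zero (U := fun q => L (F q)) (L.contDiff.comp hF) (fun p => ?_)
      (fun x hx => by simp [h0 x hx]) (fun x hx => ?_) ht htρ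
    · simp only [fderiv_clm_comp_apply hF]
      have h (v : ℝ × Space n) := congrFun (fderiv_clm_comp_apply (contDiff_fderiv_const hF v) L v) p
      simp only [h, hw p, map_sum]
    · have h := congrFun (fderiv_clm_comp_apply hF L (timeDir n)) (0, x)
      rw [h, h1 x hx, map_zero]
  exact Complex.ext (key Complex.reCLM) (key Complex.imCLM)

lemma IsWave.comp_neg {F : ℝ × Space n → ℂ} (hF : ContDiff ℝ ∞ F) (hw : IsWave F) :
    IsWave fun p : ℝ × Space n => F (-p.1, p.2) := by
  have hu : ContDiff ℝ ∞ fun p : ℝ × Space n => F (-p.1, p.2) :=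
    hF.comp (contDiff_fst.neg.prodMk contDiff_snd)
  rw [isWave_iff (u := fun t z => F (-t, z)) hu]
  intro t z
  have h := (isWave_iff (u := fun t z => F (t, z)) hF).1 hw (-t) z
  rw [← h]
  have h2 := iteratedDeriv_comp_neg 2 (fun τ => F (τ, z)) t
  simpa using h2

/-- Negative times reduce to positive ones because the wave equation is invariant under time
reversal. -/
lemma IsWave.eq_zero {F : ℝ × Space n → ℂ} (hF : ContDiff ℝ ∞ F) (hw : IsWave F)
    {x₀ : Space n} {ρ : ℝ} (h0 : ∀ x ∈ Metric.ball x₀ ρ, F (0, x) = 0)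
    (h1 : ∀ x ∈ Metric.ball x₀ ρ, deriv (fun τ => F (τ, x)) 0 = 0) {t : ℝ} (ht : |t| < ρ) :
    F (t, x₀) = 0 := by
  have h1' (x : Space n) (hx : x ∈ Metric.ball x₀ ρ) : fderiv ℝ F (0, x) (timeDir n) = 0 := by
    rw [← h1 x hx]
    exact (hasDerivAt_slice (hF.differentiable (by simp) ((0 : ℝ), x))).deriv.symm
  rcases le_total 0 t with h | h
  · exact hw.eq_zero_of_nonneg hF h0 h1' h (by rwa [abs_of_nonneg h] at ht)
  · have hu : ContDiff ℝ ∞ fun p : ℝ × Space n => F (-p.1, p.2) :=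
      hF.comp (contDiff_fst.neg.prodMk contDiff_snd)
    have := (hw.comp_neg hF).eq_zero_of_nonneg hu (x₀ := x₀) (ρ := ρ) (fun x hx => by simp [h0 x hx])
      (fun x hx => ?_) (neg_nonneg.2 h) (by rwa [abs_of_nonpos h] at ht)
    · simpa using this
    · have h3 := hasDerivAt_slice (hu.differentiable (by simp) ((0 : ℝ), x))
      rw [← h3.deriv]
      have h4 := deriv_comp_neg (fun τ => F (τ, x)) 0
      simp only [neg_zero, h1 x hx] at h4
      simpa using h4

lemma IsFreeWave.unique {u v : ℝ → Space n → ℂ} (hu : IsFreeWave u) (hv : IsFreeWave v)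
    {d : Data n} (hud : HasCauchyData u 0 d) (hvd : HasCauchyData v 0 d) : u = v := by
  have hF : ContDiff ℝ ∞ fun p : ℝ × Space n => u p.1 p.2 - v p.1 p.2 := hu.smooth.sub hv.smooth
  have hut (z : Space n) : ContDiff ℝ ∞ fun τ => u τ z := hu.smooth.comp (contDiff_prodMk_left z)
  have hvt (z : Space n) : ContDiff ℝ ∞ fun τ => v τ z := hv.smooth.comp (contDiff_prodMk_left z)
  have huz (t : ℝ) : ContDiff ℝ ∞ (u t) := hu.smooth.comp (contDiff_prodMk_right t)
  have hvz (t : ℝ) : ContDiff ℝ ∞ (v t) := hv.smooth.comp (contDiff_prodMk_right t)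
  have hw : IsWave fun p : ℝ × Space n => u p.1 p.2 - v p.1 p.2 := by
    rw [isWave_iff (u := fun t z => u t z - v t z) hF]
    intro t z
    have h1 := ((huz t).of_le two_le_infty : ContDiff ℝ 2 (u t)).contDiffAt (x := z)
    have h2 := ((hvz t).of_le two_le_infty : ContDiff ℝ 2 (v t)).contDiffAt (x := z)
    have h3 := h1.laplacian_sub h2
    have h4 := iteratedDeriv_sub (n := 2) (x := t)
      ((hut z).of_le two_le_infty : ContDiff ℝ 2 _).contDiffAt
      ((hvt z).of_le two_le_infty : ContDiff ℝ 2 _).contDiffAt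
    refine h4.trans ?_
    rw [hu.wave, hv.wave]
    exact h3.symm
  funext t x
  refine sub_eq_zero.1 (hw.eq_zero hF (x₀ := x) (ρ := |t| + 1) (t := t)
    (fun y _ => ?_) (fun y _ => ?_) (by linarith))
  · simp [(hud y).1, (hvd y).1]
  · have h1 := ((hut y).differentiable (by simp)) 0
    have h2 := ((hvt y).differentiable (by simp)) 0
    rw [deriv_fun_sub h1 h2, (hud y).2, (hvd y).2, sub_self]

lemma IsWave.locUnifCompactSupport {F : ℝ × Space n → ℂ} (hF : ContDiff ℝ ∞ F) (hw : IsWave F)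
    {r : ℝ} (h0 : ∀ x, r < ‖x‖ → F (0, x) = 0)
    (h1 : ∀ x, r < ‖x‖ → deriv (fun τ => F (τ, x)) 0 = 0) : LocUnifCompactSupport F := by
  intro T
  -- The extra one makes the ball of radius `T + 1` around `z`, on which the data vanish, strictly
  -- larger than `|t|`.
  refine ⟨r + T + 1, fun t z ht hz => ?_⟩
  have hball (x : Space n) (hx : x ∈ Metric.ball z (T + 1)) : r < ‖x‖ := by
    rw [mem_ball, dist_eq_norm] at hx
    have := norm_sub_norm_le z x
    rw [norm_sub_rev] at this
    linarith
  exact hw.eq_zero hF (ρ := T + 1) (fun x hx => h0 x (hball x hx)) (fun x hx => h1 x (hball x hx))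
    (by linarith)

end FiniteSpeed

/-! ### Solving the Cauchy problem by Fourier multipliers -/

section WaveFourier

open scoped FourierTransform SchwartzMap

variable {n : ℕ}

/-- The multiplier of the sine propagator, `sin (2π t |ξ|) / (2π |ξ|)`. -/
def sineMult (t : ℝ) (ξ : Space n) : ℝ := t * Real.sinc (2 * Real.pi * t * ‖ξ‖)

lemma two_pi_norm_mul_sineMult (t : ℝ) (ξ : Space n) :
    2 * Real.pi * ‖ξ‖ * sineMult t ξ = Real.sin (2 * Real.pi * t * ‖ξ‖) := by
  unfold sineMult
  rcases eq_or_ne (2 * Real.pi * t * ‖ξ‖) 0 with h | h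
  · rw [h, Real.sinc_zero, Real.sin_zero]; linarith
  · rw [Real.sinc_of_ne_zero h, ← mul_assoc, mul_right_comm _ ‖ξ‖ t]
    exact mul_div_cancel₀ _ h

lemma abs_sineMult_le (t : ℝ) (ξ : Space n) : |sineMult t ξ| ≤ |t| := by
  rw [sineMult, abs_mul]
  exact mul_le_of_le_one_right (abs_nonneg _) (Real.abs_sinc_le_one _)

lemma continuous_sineMult (t : ℝ) : Continuous (sineMult (n := n) t) :=
  continuous_const.mul (Real.continuous_sinc.comp (by fun_prop))

lemma hasDerivAt_sineMult (t : ℝ) (ξ : Space n) :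
    HasDerivAt (fun τ => sineMult τ ξ) (Real.cos (2 * Real.pi * t * ‖ξ‖)) t := by
  rcases eq_or_ne ‖ξ‖ 0 with h | h
  · simpa [sineMult, h] using hasDerivAt_id' t
  · have hc : 2 * Real.pi * ‖ξ‖ ≠ 0 := by positivity
    have h1 : (fun τ => sineMult τ ξ) =
        fun τ => (2 * Real.pi * ‖ξ‖)⁻¹ * Real.sin (2 * Real.pi * τ * ‖ξ‖) := by
      funext τ
      rw [← two_pi_norm_mul_sineMult, inv_mul_cancel_left₀ hc]
    rw [h1]
    have h2 : HasDerivAt (fun τ : ℝ => 2 * Real.pi * τ * ‖ξ‖) (2 * Real.pi * ‖ξ‖) t := by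
      simpa using ((hasDerivAt_id t).const_mul (2 * Real.pi)).mul_const ‖ξ‖
    refine (h2.sin.const_mul _).congr_deriv ?_
    field_simp

/-- The inner product as a continuous bilinear map. -/
def realInner (n : ℕ) : Space n →L[ℝ] Space n →L[ℝ] ℝ := innerSL ℝ

/-- The phase pairing on `ℝⁿ × ℝ` and `ℝ × ℝⁿ`. -/
def phasePairing (n : ℕ) : Space n × ℝ →L[ℝ] ℝ × Space n →L[ℝ] ℝ :=
  -((realInner n).bilinearComp (ContinuousLinearMap.fst ℝ (Space n) ℝ)
      (ContinuousLinearMap.snd ℝ ℝ (Space n)) +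
    (ContinuousLinearMap.mul ℝ ℝ).bilinearComp (ContinuousLinearMap.snd ℝ (Space n) ℝ)
      (ContinuousLinearMap.fst ℝ ℝ (Space n)))

lemma phasePairing_apply (v : Space n × ℝ) (w : ℝ × Space n) :
    phasePairing n v w = -(inner ℝ v.1 w.2 + v.2 * w.1) := rfl

/-- The image of `dξ dr` on `ℝⁿ × [-1,1]` in the solid light cone. -/
def coneMeasure (n : ℕ) : Measure (Space n × ℝ) :=
  ((volume : Measure (Space n)).prod (volume.restrict (Set.Icc (-1 : ℝ) 1))).map
    fun p => (p.1, p.2 * ‖p.1‖)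

lemma measurable_coneMap : Measurable fun p : Space n × ℝ => (p.1, p.2 * ‖p.1‖) := by
  fun_prop

/-- On the solid cone the last coordinate is at most `|ξ|` in size, so the sup norm of a point is
`|ξ|` and the moments are those of a Schwartz function. They give smoothness of the Fourier
transform over the cone. -/
lemma integrable_coneMeasure (b : 𝓢(Space n, ℂ)) (k : ℕ) :
    Integrable (fun v : Space n × ℝ => ‖v‖ ^ k * ‖b v.1‖) (coneMeasure n) := by
  have hb : Continuous fun v : Space n × ℝ => ‖v‖ ^ k * ‖b v.1‖ := by
    have := b.continuous
    fun_prop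
  rw [coneMeasure, integrable_map_measure hb.aestronglyMeasurable measurable_coneMap.aemeasurable]
  have h1 : Integrable (fun p : Space n × ℝ => ‖p.1‖ ^ k * ‖b p.1‖)
      ((volume : Measure (Space n)).prod (volume.restrict (Set.Icc (-1 : ℝ) 1))) :=
    (b.integrable_pow_mul volume k).comp_fst _
  refine h1.mono' (hb.comp (by fun_prop)).aestronglyMeasurable ?_
  have h2 : ∀ᵐ p : Space n × ℝ ∂((volume : Measure (Space n)).prod
      (volume.restrict (Set.Icc (-1 : ℝ) 1))), p.2 ∈ Set.Icc (-1 : ℝ) 1 :=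
    Measure.quasiMeasurePreserving_snd.ae (ae_restrict_mem measurableSet_Icc)
  filter_upwards [h2] with p hp
  have h3 : ‖p.2 * ‖p.1‖‖ ≤ ‖p.1‖ := by
    rw [norm_mul, norm_norm]
    exact mul_le_of_le_one_left (norm_nonneg _) (abs_le.2 hp)
  simp only [Function.comp_apply, norm_mul, norm_pow, norm_norm, Prod.norm_def]
  rw [max_eq_left (by simpa using h3), norm_norm]

lemma integral_fourierChar_Icc (c : ℝ) :
    ∫ r in Set.Icc (-1 : ℝ) 1, (Real.fourierChar (c * r) : ℂ) =
      2 * Real.sinc (2 * Real.pi * c) := by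
  rw [integral_Icc_eq_integral_Ioc, ← intervalIntegral.integral_of_le (by norm_num)]
  rcases eq_or_ne c 0 with rfl | hc
  · simp; norm_num
  have h2 : 2 * Real.pi * c ≠ 0 := by positivity
  have h := intervalIntegral.integral_comp_mul_left (a := -1) (b := 1)
    (fun x : ℝ => Complex.exp (x * Complex.I)) h2
  have h3 : (fun r : ℝ => (Real.fourierChar (c * r) : ℂ)) =
      fun r : ℝ => Complex.exp ((2 * Real.pi * c * r : ℝ) * Complex.I) := by
    funext r; rw [Real.fourierChar_apply]; ring_nf
  rw [h3, h, mul_neg_one, mul_one, integral_exp_mul_I_eq_sinc, Complex.real_smul]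
  push_cast
  have h4 : (c : ℂ) ≠ 0 := mod_cast hc
  field_simp

/-- The multiplier is an average of characters, `t sinc(2πt|ξ|) = (t/2) ∫ e^(2πi r t|ξ|) dr` over
`[-1, 1]`. Time thus becomes a variable dual to `r|ξ|`, on the same footing as `x`, and smoothness
in `(t, x)` follows from differentiability of Fourier transforms with finite moments. -/
lemma sinePropagator_eq (b : 𝓢(Space n, ℂ)) (t : ℝ) (x : Space n) :
    𝓕⁻ (fun ξ => (sineMult t ξ : ℂ) * b ξ) x = (t / 2 : ℂ) *
      VectorFourier.fourierIntegral Real.fourierChar (coneMeasure n)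
        (phasePairing n).toLinearMap₁₂ (fun v => b v.1) (t, x) := by
  have hb : Continuous fun v : Space n × ℝ =>
      Real.fourierChar (inner ℝ v.1 x + v.2 * t) • b v.1 := by
    have := b.continuous
    have := Real.continuous_fourierChar
    fun_prop
  have h1 : VectorFourier.fourierIntegral Real.fourierChar (coneMeasure n)
      (phasePairing n).toLinearMap₁₂ (fun v => b v.1) (t, x) =
      ∫ v, Real.fourierChar (inner ℝ v.1 x + v.2 * t) • b v.1 ∂coneMeasure n := by
    simp only [VectorFourier.fourierIntegral]
    refine integral_congr_ae (.of_forall fun v => ?_)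
    change Real.fourierChar (-(phasePairing n v (t, x))) • b v.1 = _
    rw [phasePairing_apply, neg_neg]
  have hint : Integrable (fun v : Space n × ℝ =>
      Real.fourierChar (inner ℝ v.1 x + v.2 * t) • b v.1) (coneMeasure n) := by
    refine (integrable_coneMeasure b 0).mono' hb.aestronglyMeasurable (.of_forall fun v => ?_)
    simp [Circle.norm_smul]
  rw [h1]
  rw [coneMeasure, integrable_map_measure hb.aestronglyMeasurable
    measurable_coneMap.aemeasurable] at hint
  replace hint : Integrable (fun p : Space n × ℝ =>
      Real.fourierChar (inner ℝ p.1 x + p.2 * ‖p.1‖ * t) • b p.1)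
      ((volume : Measure (Space n)).prod (volume.restrict (Set.Icc (-1 : ℝ) 1))) := hint
  rw [coneMeasure, integral_map measurable_coneMap.aemeasurable hb.aestronglyMeasurable]
  rw [integral_prod _ hint, Real.fourierInv_eq, ← integral_const_mul]
  refine integral_congr_ae (.of_forall fun ξ => ?_)
  have h2 (r : ℝ) : Real.fourierChar (inner ℝ ξ x + r * ‖ξ‖ * t) • b ξ =
      (Real.fourierChar ((t * ‖ξ‖) * r) : ℂ) * (Real.fourierChar (inner ℝ ξ x) • b ξ) := by
    rw [AddChar.map_add_eq_mul, Circle.smul_def, Circle.smul_def, Circle.coe_mul, smul_eq_mul,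
      smul_eq_mul, show r * ‖ξ‖ * t = t * ‖ξ‖ * r by ring]
    ring
  simp only [h2]
  rw [integral_mul_const, integral_fourierChar_Icc]
  simp only [Circle.smul_def, smul_eq_mul, sineMult]
  push_cast
  rw [← mul_assoc (2 * Real.pi) t ‖ξ‖]
  ring

lemma contDiff_sinePropagator (b : 𝓢(Space n, ℂ)) :
    ContDiff ℝ ∞ fun p : ℝ × Space n => 𝓕⁻ (fun ξ => (sineMult p.1 ξ : ℂ) * b ξ) p.2 := by
  simp only [sinePropagator_eq]
  refine ContDiff.mul ?_ ?_
  · exact (Complex.ofRealCLM.contDiff.comp contDiff_fst).div_const _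
  · exact VectorFourier.contDiff_fourierIntegral (N := ⊤) (phasePairing n)
      fun k _ => integrable_coneMeasure b k

lemma hasDerivAt_fourierInv {m m' : ℝ → Space n → ℂ} {bound : Space n → ℝ}
    (hm : ∀ t, Continuous (m t)) (hm' : ∀ t, Continuous (m' t)) {t : ℝ} {x : Space n}
    (hint : Integrable (m t)) (hd : ∀ τ ξ, HasDerivAt (fun s => m s ξ) (m' τ ξ) τ)
    (hb : ∀ τ ξ, ‖m' τ ξ‖ ≤ bound ξ) (hbi : Integrable bound) :
    HasDerivAt (fun τ => 𝓕⁻ (m τ) x) (𝓕⁻ (m' t) x) t := by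
  simp only [Real.fourierInv_eq]
  have hc (f : Space n → ℂ) (hf : Continuous f) :
      Continuous fun ξ => Real.fourierChar (inner ℝ ξ x) • f ξ := by
    have := Real.continuous_fourierChar
    fun_prop
  refine (hasDerivAt_integral_of_dominated_loc_of_deriv_le (bound := bound)
    (F' := fun τ ξ => Real.fourierChar (inner ℝ ξ x) • m' τ ξ) Filter.univ_mem
    (.of_forall fun τ => (hc _ (hm τ)).aestronglyMeasurable) ?_
    (hc _ (hm' t)).aestronglyMeasurable (.of_forall fun ξ τ _ => ?_) hbi
    (.of_forall fun ξ τ _ => ?_)).2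
  · exact hint.norm.mono' (hc _ (hm t)).aestronglyMeasurable
      (.of_forall fun ξ => by simp [Circle.norm_smul])
  · rw [Circle.norm_smul]; exact hb τ ξ
  · simp only [Circle.smul_def]
    exact (hd τ ξ).const_mul _

/-- Stated for continuous `m` with two finite moments, because the wave multipliers involve `|ξ|`
and are not treated as Schwartz functions. -/
lemma laplacian_fourierInv {m : Space n → ℂ} (hm : Continuous m)
    (hint : ∀ k ≤ 2, Integrable fun ξ => ‖ξ‖ ^ k * ‖m ξ‖) (x : Space n) :
    (Δ (𝓕⁻ m)) x = 𝓕⁻ (fun ξ => -((2 * Real.pi * ‖ξ‖ : ℝ) : ℂ) ^ 2 * m ξ) x := by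
  have hi : ∀ k : ℕ, (k : ℕ∞) ≤ (2 : ℕ∞) → Integrable fun ξ => ‖ξ‖ ^ k * ‖m (-ξ)‖ := fun k hk => by
    simpa using (hint k (by exact_mod_cast hk)).comp_neg
  have hmn : Continuous fun ξ => m (-ξ) := hm.comp continuous_neg
  rw [Real.fourierInv_eq_fourier_comp_neg, Real.fourierInv_eq_fourier_comp_neg,
    InnerProductSpace.laplacian_eq_iteratedFDeriv_orthonormalBasis _
      (EuclideanSpace.basisFun (Fin n) ℝ),
    Real.iteratedFDeriv_fourier hi hmn.aestronglyMeasurable le_rfl]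
  have hpi : Integrable fun v => VectorFourier.fourierPowSMulRight (innerSL ℝ)
      (fun ξ => m (-ξ)) v 2 :=
    VectorFourier.integrable_fourierPowSMulRight _ (hi 2 le_rfl) hmn.aestronglyMeasurable
  simp only [Real.fourier_eq]
  have happ (M : Fin 2 → Space n) :
      (∫ v, Real.fourierChar (-inner ℝ v x) • VectorFourier.fourierPowSMulRight (innerSL ℝ)
        (fun ξ => m (-ξ)) v 2) M = ∫ v, Real.fourierChar (-inner ℝ v x) •
          VectorFourier.fourierPowSMulRight (innerSL ℝ) (fun ξ => m (-ξ)) v 2 M := by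
    rw [ContinuousMultilinearMap.integral_apply]
    · rfl
    · exact (Real.fourierIntegral_convergent_iff x).2 hpi
  simp only [happ]
  rw [← integral_finsetSum]
  · refine integral_congr_ae (.of_forall fun v => ?_)
    simp only [← Finset.smul_sum]
    congr 1
    simp only [VectorFourier.fourierPowSMulRight_apply, Fin.prod_univ_two,
      Matrix.cons_val_zero, Matrix.cons_val_one, ← Finset.smul_sum, ← Finset.sum_smul]
    have hsum : ∑ i, inner ℝ v (EuclideanSpace.basisFun (Fin n) ℝ i) *
        inner ℝ v (EuclideanSpace.basisFun (Fin n) ℝ i) = ‖v‖ ^ 2 := by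
      rw [EuclideanSpace.real_norm_sq_eq]
      simp [EuclideanSpace.inner_single_right, sq]
    change (-(2 * Real.pi * Complex.I) : ℂ) ^ 2 • (∑ i, inner ℝ v (EuclideanSpace.basisFun (Fin n)
      ℝ i) * inner ℝ v (EuclideanSpace.basisFun (Fin n) ℝ i)) • m (-v) = _
    rw [hsum, norm_neg]
    simp only [smul_eq_mul, Complex.real_smul]
    push_cast
    have := Complex.I_sq
    linear_combination (4 * Real.pi ^ 2 * ‖v‖ ^ 2 * m (-v) : ℂ) * this
  · intro i _
    have h1 := ((Real.fourierIntegral_convergent_iff x).2 hpi)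
    exact (ContinuousMultilinearMap.apply ℝ (fun _ : Fin 2 => Space n) ℂ
      ![EuclideanSpace.basisFun (Fin n) ℝ i, EuclideanSpace.basisFun (Fin n) ℝ i]).integrable_comp h1

/-- The Fourier transform at time `t` of the free wave whose Cauchy data have the Fourier
transforms `a` and `b`. -/
def waveHat (a b : 𝓢(Space n, ℂ)) (t : ℝ) (ξ : Space n) : ℂ :=
  (Real.cos (2 * Real.pi * t * ‖ξ‖) : ℂ) * a ξ + (sineMult t ξ : ℂ) * b ξ

/-- The Fourier transform of the velocity at time `t` of the free wave whose Cauchy data have the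
Fourier transforms `a` and `b`. -/
def waveHatDeriv (a b : 𝓢(Space n, ℂ)) (t : ℝ) (ξ : Space n) : ℂ :=
  (-(2 * Real.pi * ‖ξ‖ * Real.sin (2 * Real.pi * t * ‖ξ‖)) : ℝ) * a ξ
    + (Real.cos (2 * Real.pi * t * ‖ξ‖) : ℂ) * b ξ

lemma continuous_waveHat (a b : 𝓢(Space n, ℂ)) (t : ℝ) : Continuous (waveHat a b t) := by
  have := a.continuous
  have := b.continuous
  have := continuous_sineMult (n := n) t
  unfold waveHat
  fun_prop

lemma continuous_waveHatDeriv (a b : 𝓢(Space n, ℂ)) (t : ℝ) : Continuous (waveHatDeriv a b t) := by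
  have := a.continuous
  have := b.continuous
  unfold waveHatDeriv
  fun_prop

lemma hasDerivAt_cos_mult (t c : ℝ) :
    HasDerivAt (fun τ : ℝ => Real.cos (2 * Real.pi * τ * c))
      (-(2 * Real.pi * c * Real.sin (2 * Real.pi * t * c))) t := by
  have h2 : HasDerivAt (fun τ : ℝ => 2 * Real.pi * τ * c) (2 * Real.pi * c) t := by
    simpa using ((hasDerivAt_id t).const_mul (2 * Real.pi)).mul_const c
  exact h2.cos.congr_deriv (by ring)

lemma hasDerivAt_sin_mult (t c : ℝ) :
    HasDerivAt (fun τ : ℝ => Real.sin (2 * Real.pi * τ * c))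
      (2 * Real.pi * c * Real.cos (2 * Real.pi * t * c)) t := by
  have h2 : HasDerivAt (fun τ : ℝ => 2 * Real.pi * τ * c) (2 * Real.pi * c) t := by
    simpa using ((hasDerivAt_id t).const_mul (2 * Real.pi)).mul_const c
  exact h2.sin.congr_deriv (by ring)

lemma hasDerivAt_waveHat (a b : 𝓢(Space n, ℂ)) (t : ℝ) (ξ : Space n) :
    HasDerivAt (fun τ => waveHat a b τ ξ) (waveHatDeriv a b t ξ) t :=
  ((hasDerivAt_cos_mult t ‖ξ‖).ofReal_comp.mul_const _).add
    ((hasDerivAt_sineMult t ξ).ofReal_comp.mul_const _)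

lemma hasDerivAt_waveHatDeriv (a b : 𝓢(Space n, ℂ)) (t : ℝ) (ξ : Space n) :
    HasDerivAt (fun τ => waveHatDeriv a b τ ξ)
      (-((2 * Real.pi * ‖ξ‖ : ℝ) : ℂ) ^ 2 * waveHat a b t ξ) t := by
  have h := ((((hasDerivAt_sin_mult t ‖ξ‖).const_mul
    (2 * Real.pi * ‖ξ‖)).neg.ofReal_comp).mul_const (a ξ)).add
    ((hasDerivAt_cos_mult t ‖ξ‖).ofReal_comp.mul_const (b ξ))
  refine h.congr_deriv ?_
  rw [← two_pi_norm_mul_sineMult, waveHat]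
  push_cast
  ring

lemma norm_mul_le_of_abs_le {c C : ℝ} (hc : |c| ≤ C) (z : ℂ) : ‖(c : ℂ) * z‖ ≤ C * ‖z‖ := by
  rw [norm_mul, Complex.norm_real, Real.norm_eq_abs]
  gcongr

lemma norm_waveHat_le (a b : 𝓢(Space n, ℂ)) (t : ℝ) (ξ : Space n) :
    ‖waveHat a b t ξ‖ ≤ ‖a ξ‖ + |t| * ‖b ξ‖ :=
  (norm_add_le _ _).trans (add_le_add
    ((norm_mul_le_of_abs_le (Real.abs_cos_le_one _) _).trans_eq (one_mul _))
    (norm_mul_le_of_abs_le (abs_sineMult_le _ _) _))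

lemma norm_waveHatDeriv_le (a b : 𝓢(Space n, ℂ)) (t : ℝ) (ξ : Space n) :
    ‖waveHatDeriv a b t ξ‖ ≤ 2 * Real.pi * ‖ξ‖ * ‖a ξ‖ + ‖b ξ‖ := by
  refine (norm_add_le _ _).trans (add_le_add (norm_mul_le_of_abs_le ?_ _)
    ((norm_mul_le_of_abs_le (Real.abs_cos_le_one _) _).trans_eq (one_mul _)))
  rw [abs_neg, abs_mul, abs_of_nonneg (by positivity)]
  exact mul_le_of_le_one_right (by positivity) (Real.abs_sin_le_one _)

lemma integrable_pow_mul_waveHat (a b : 𝓢(Space n, ℂ)) (t : ℝ) (k : ℕ) :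
    Integrable fun ξ => ‖ξ‖ ^ k * ‖waveHat a b t ξ‖ := by
  refine ((a.integrable_pow_mul volume k).add
    ((b.integrable_pow_mul volume k).const_mul |t|)).mono' ?_ (.of_forall fun ξ => ?_)
  · have := continuous_waveHat a b t
    exact Continuous.aestronglyMeasurable (by fun_prop)
  · rw [Real.norm_of_nonneg (by positivity)]
    calc _ ≤ ‖ξ‖ ^ k * (‖a ξ‖ + |t| * ‖b ξ‖) := by gcongr; exact norm_waveHat_le a b t ξ
      _ = _ := by simp only [Pi.add_apply]; ring

lemma integrable_waveHat (a b : 𝓢(Space n, ℂ)) (t : ℝ) : Integrable (waveHat a b t) := by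
  have := integrable_pow_mul_waveHat a b t 0
  simp only [pow_zero, one_mul] at this
  exact (integrable_norm_iff (continuous_waveHat a b t).aestronglyMeasurable).1 this

lemma integrable_waveHatDeriv_bound (a b : 𝓢(Space n, ℂ)) :
    Integrable fun ξ => 2 * Real.pi * ‖ξ‖ * ‖a ξ‖ + ‖b ξ‖ := by
  refine Integrable.add ?_ b.integrable.norm
  simpa [mul_assoc] using (a.integrable_pow_mul volume 1).const_mul (2 * Real.pi)

lemma integrable_waveHatDeriv (a b : 𝓢(Space n, ℂ)) (t : ℝ) : Integrable (waveHatDeriv a b t) :=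
  (integrable_waveHatDeriv_bound a b).mono' (continuous_waveHatDeriv a b t).aestronglyMeasurable
    (.of_forall (norm_waveHatDeriv_le a b t))

lemma hasDerivAt_fourierInv_waveHat (a b : 𝓢(Space n, ℂ)) (t : ℝ) (x : Space n) :
    HasDerivAt (fun τ => 𝓕⁻ (waveHat a b τ) x) (𝓕⁻ (waveHatDeriv a b t) x) t :=
  hasDerivAt_fourierInv (continuous_waveHat a b) (continuous_waveHatDeriv a b)
    (integrable_waveHat a b t) (hasDerivAt_waveHat a b) (norm_waveHatDeriv_le a b)
    (integrable_waveHatDeriv_bound a b)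

lemma hasDerivAt_fourierInv_waveHatDeriv (a b : 𝓢(Space n, ℂ)) (t : ℝ) (x : Space n) :
    HasDerivAt (fun τ => 𝓕⁻ (waveHatDeriv a b τ) x)
      (𝓕⁻ (fun ξ => -((2 * Real.pi * ‖ξ‖ : ℝ) : ℂ) ^ 2 * waveHat a b t ξ) x) t := by
  refine hasDerivAt_fourierInv (m' := fun τ ξ => -((2 * Real.pi * ‖ξ‖ : ℝ) : ℂ) ^ 2 * waveHat a b τ ξ)
    (bound := fun ξ => (2 * Real.pi) ^ 2 * (‖ξ‖ ^ 2 * ‖a ξ‖) + 2 * Real.pi * (‖ξ‖ ^ 1 * ‖b ξ‖))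
    (continuous_waveHatDeriv a b) (fun τ => ?_) (integrable_waveHatDeriv a b t)
    (hasDerivAt_waveHatDeriv a b) (fun τ ξ => ?_) ?_
  · have := continuous_waveHat a b τ
    fun_prop
  · have h : -((2 * Real.pi * ‖ξ‖ : ℝ) : ℂ) ^ 2 * waveHat a b τ ξ =
        ((-((2 * Real.pi * ‖ξ‖) ^ 2 * Real.cos (2 * Real.pi * τ * ‖ξ‖)) : ℝ) : ℂ) * a ξ +
        ((-(2 * Real.pi * ‖ξ‖ * Real.sin (2 * Real.pi * τ * ‖ξ‖)) : ℝ) : ℂ) * b ξ := by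
      rw [← two_pi_norm_mul_sineMult, waveHat]
      push_cast
      ring
    rw [h]
    refine (norm_add_le _ _).trans (add_le_add ?_ ?_)
    · refine (norm_mul_le_of_abs_le (C := (2 * Real.pi * ‖ξ‖) ^ 2) ?_ _).trans_eq (by ring)
      rw [abs_neg, abs_mul, abs_of_nonneg (by positivity)]
      exact mul_le_of_le_one_right (by positivity) (Real.abs_cos_le_one _)
    · refine (norm_mul_le_of_abs_le (C := 2 * Real.pi * ‖ξ‖) ?_ _).trans_eq (by ring)
      rw [abs_neg, abs_mul, abs_of_nonneg (by positivity)]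
      exact mul_le_of_le_one_right (by positivity) (Real.abs_sin_le_one _)
  · exact ((a.integrable_pow_mul volume 2).const_mul _).add
      ((b.integrable_pow_mul volume 1).const_mul _)

lemma waveHat_zero_left (b : 𝓢(Space n, ℂ)) (t : ℝ) :
    waveHat 0 b t = fun ξ => (sineMult t ξ : ℂ) * b ξ := by
  funext ξ; simp [waveHat]

lemma waveHat_zero_right (a : 𝓢(Space n, ℂ)) (t : ℝ) :
    waveHat a 0 t = fun ξ => (Real.cos (2 * Real.pi * t * ‖ξ‖) : ℂ) * a ξ := by
  funext ξ; simp [waveHat]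

lemma waveHatDeriv_zero_left (b : 𝓢(Space n, ℂ)) (t : ℝ) :
    waveHatDeriv 0 b t = fun ξ => (Real.cos (2 * Real.pi * t * ‖ξ‖) : ℂ) * b ξ := by
  funext ξ; simp [waveHatDeriv]

/-- The cosine propagator is the time derivative of the sine propagator, so its smoothness is
inherited from `contDiff_sinePropagator`. -/
lemma contDiff_fourierInv_waveHat (a b : 𝓢(Space n, ℂ)) :
    ContDiff ℝ ∞ fun p : ℝ × Space n => 𝓕⁻ (waveHat a b p.1) p.2 := by
  have hzero (c : 𝓢(Space n, ℂ)) (t : ℝ) (x : Space n) :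
      HasDerivAt (fun τ => 𝓕⁻ (fun ξ => (sineMult τ ξ : ℂ) * c ξ) x)
        (𝓕⁻ (fun ξ => (Real.cos (2 * Real.pi * t * ‖ξ‖) : ℂ) * c ξ) x) t := by
    have := hasDerivAt_fourierInv_waveHat 0 c t x
    simpa only [waveHat_zero_left, waveHatDeriv_zero_left] using this
  have h1 : (fun p : ℝ × Space n => 𝓕⁻ (waveHat a b p.1) p.2) = fun p =>
      fderiv ℝ (fun p : ℝ × Space n => 𝓕⁻ (fun ξ => (sineMult p.1 ξ : ℂ) * a ξ) p.2) p (timeDir n)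
        + 𝓕⁻ (fun ξ => (sineMult p.1 ξ : ℂ) * b ξ) p.2 := by
    funext p
    have h2 := hasDerivAt_slice ((contDiff_sinePropagator a).differentiable (by simp) p)
    rw [h2.unique (hzero a p.1 p.2)]
    have hi1 : Integrable fun ξ => (Real.cos (2 * Real.pi * p.1 * ‖ξ‖) : ℂ) * a ξ := by
      simpa only [waveHat_zero_right] using integrable_waveHat a 0 p.1
    have hi2 : Integrable fun ξ => (sineMult p.1 ξ : ℂ) * b ξ := by
      simpa only [waveHat_zero_left] using integrable_waveHat 0 b p.1
    simp only [Real.fourierInv_eq]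
    rw [← integral_add]
    · refine integral_congr_ae (.of_forall fun ξ => ?_)
      simp only [waveHat, smul_add]
    · simpa using (Real.fourierIntegral_convergent_iff (-p.2)).2 hi1
    · simpa using (Real.fourierIntegral_convergent_iff (-p.2)).2 hi2
  rw [h1]
  exact (contDiff_fderiv_const (contDiff_sinePropagator a) _).add (contDiff_sinePropagator b)

lemma isWave_fourierInv_waveHat (a b : 𝓢(Space n, ℂ)) :
    IsWave fun p : ℝ × Space n => 𝓕⁻ (waveHat a b p.1) p.2 := by
  rw [isWave_iff (u := fun t x => 𝓕⁻ (waveHat a b t) x) (contDiff_fourierInv_waveHat a b)]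
  intro t x
  have h1 : deriv (fun τ => 𝓕⁻ (waveHat a b τ) x) = fun τ => 𝓕⁻ (waveHatDeriv a b τ) x :=
    funext fun τ => (hasDerivAt_fourierInv_waveHat a b τ x).deriv
  rw [iteratedDeriv_succ, iteratedDeriv_one, h1, (hasDerivAt_fourierInv_waveHatDeriv a b t x).deriv]
  exact (laplacian_fourierInv (continuous_waveHat a b t)
    (fun k _ => integrable_pow_mul_waveHat a b t k) x).symm

/-- A test function as a Schwartz function. -/
def testToSchwartz (f : Test n) : 𝓢(Space n, ℂ) := f.hasCompactSupport.toSchwartzMap f.contDiff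

@[simp] lemma testToSchwartz_apply (f : Test n) (x : Space n) : testToSchwartz f x = f x := rfl

/-- The free wave with Cauchy data `d`. -/
def freeWave (d : Data n) (t : ℝ) (x : Space n) : ℂ :=
  𝓕⁻ (waveHat (𝓕 (testToSchwartz d.1)) (𝓕 (testToSchwartz d.2)) t) x

lemma fourierInv_fourier_testToSchwartz (f : Test n) (x : Space n) :
    𝓕⁻ ((𝓕 (testToSchwartz f) : 𝓢(Space n, ℂ)) : Space n → ℂ) x = f x := by
  rw [← SchwartzMap.fourierInv_coe, FourierTransform.fourierInv_fourier_eq, testToSchwartz_apply]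

lemma deriv_freeWave (d : Data n) (t : ℝ) (x : Space n) : deriv (fun τ => freeWave d τ x) t =
    𝓕⁻ (waveHatDeriv (𝓕 (testToSchwartz d.1)) (𝓕 (testToSchwartz d.2)) t) x :=
  (hasDerivAt_fourierInv_waveHat _ _ t x).deriv

lemma hasCauchyData_freeWave (d : Data n) : HasCauchyData (freeWave d) 0 d := by
  intro z
  constructor
  · rw [freeWave, ← fourierInv_fourier_testToSchwartz]
    refine congrArg (fun m : Space n → ℂ => 𝓕⁻ m z) (funext fun ξ => ?_)
    simp [waveHat, sineMult]
  · rw [deriv_freeWave, ← fourierInv_fourier_testToSchwartz]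
    refine congrArg (fun m : Space n → ℂ => 𝓕⁻ m z) (funext fun ξ => ?_)
    simp [waveHatDeriv]

lemma exists_radius_data (d : Data n) : ∃ r : ℝ, ∀ x, r < ‖x‖ → d.1 x = 0 ∧ d.2 x = 0 := by
  have h (f : Test n) : ∃ r : ℝ, ∀ x, r < ‖x‖ → f x = 0 := by
    obtain ⟨r, hr⟩ := f.hasCompactSupport.isCompact.isBounded.exists_norm_le
    exact ⟨r, fun x hx => image_eq_zero_of_notMem_tsupport fun h => hx.not_ge (hr x h)⟩
  obtain ⟨r, hr⟩ := h d.1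
  obtain ⟨r', hr'⟩ := h d.2
  exact ⟨max r r', fun x hx => ⟨hr x ((le_max_left _ _).trans_lt hx),
    hr' x ((le_max_right _ _).trans_lt hx)⟩⟩

lemma isFreeWave_freeWave (d : Data n) : IsFreeWave (freeWave d) := by
  have hF := contDiff_fourierInv_waveHat (𝓕 (testToSchwartz d.1)) (𝓕 (testToSchwartz d.2))
  have hw := isWave_fourierInv_waveHat (𝓕 (testToSchwartz d.1)) (𝓕 (testToSchwartz d.2))
  obtain ⟨r, hr⟩ := exists_radius_data d
  have hc := hasCauchyData_freeWave d
  exact ⟨hF, hw.locUnifCompactSupport hF (r := r) (fun x hx => (hc x).1.trans (hr x hx).1)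
    (fun x hx => (hc x).2.trans (hr x hx).2), (isWave_iff (u := freeWave d) hF).1 hw⟩

lemma IsFreeWave.exists_data {u : ℝ → Space n → ℂ} (hu : IsFreeWave u) (t : ℝ) :
    ∃ d : Data n, HasCauchyData u t d := by
  have hs : LocUnifCompactSupport fun p : ℝ × Space n => u p.1 p.2 := hu.support
  have hd := hu.smooth.differentiable (by simp)
  have h2 (z : Space n) : deriv (fun τ => u τ z) t =
      fderiv ℝ (fun p : ℝ × Space n => u p.1 p.2) (t, z) (1, 0) :=
    (hasDerivAt_slice (hd (t, z))).deriv
  refine ⟨(⟨u t, hu.smooth.comp (contDiff_prodMk_right t), hs.hasCompactSupport t, by simp⟩,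
    ⟨fun z => fderiv ℝ (fun p : ℝ × Space n => u p.1 p.2) (t, z) (1, 0),
      (contDiff_fderiv_const hu.smooth _).comp (contDiff_prodMk_right t),
      (hs.fderiv_time hd).hasCompactSupport t, by simp⟩), fun z => ⟨rfl, h2 z⟩⟩

/-- Inversion applies to the merely continuous `m` because its Fourier transform is the reflection
of `f`, hence integrable. It recovers the Fourier transforms of the evolved data, which are again
test functions. -/
lemma fourier_eq_of_eq_fourierInv {f : 𝓢(Space n, ℂ)} {m : Space n → ℂ} (hm : Continuous m)
    (hi : Integrable m) (h : ∀ x, f x = 𝓕⁻ m x) (ξ : Space n) : 𝓕 f ξ = m ξ := by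
  have h1 : ⇑f = 𝓕⁻ m := funext h
  have h2 : 𝓕 m = fun x => f (-x) := by
    funext x
    rw [h, Real.fourierInv_eq_fourier_neg, neg_neg]
  rw [SchwartzMap.fourier_coe, h1, hm.fourier_fourierInv_eq hi (by rw [h2]; exact f.integrable.comp_neg)]

lemma fourier_data_fst {d e : Data n} {t : ℝ} (he : HasCauchyData (freeWave d) t e) (ξ : Space n) :
    𝓕 (testToSchwartz e.1) ξ =
      waveHat (𝓕 (testToSchwartz d.1)) (𝓕 (testToSchwartz d.2)) t ξ :=
  fourier_eq_of_eq_fourierInv (continuous_waveHat _ _ t) (integrable_waveHat _ _ t)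
    (fun x => (he x).1.symm) ξ

lemma fourier_data_snd {d e : Data n} {t : ℝ} (he : HasCauchyData (freeWave d) t e) (ξ : Space n) :
    𝓕 (testToSchwartz e.2) ξ =
      waveHatDeriv (𝓕 (testToSchwartz d.1)) (𝓕 (testToSchwartz d.2)) t ξ :=
  fourier_eq_of_eq_fourierInv (continuous_waveHatDeriv _ _ t) (integrable_waveHatDeriv _ _ t)
    (fun x => (he x).2.symm.trans (deriv_freeWave d t x)) ξ

end WaveFourier

/-! ### The Radon transform and the Fourier slice theorem -/

section RadonTransform

open scoped FourierTransform SchwartzMap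

variable {n : ℕ}

/-- The direction space of the hyperplanes `⟨z, θ⟩ = s`. -/
abbrev hyperplaneDir (θ : Sph n) : Submodule ℝ (Space n) := (Submodule.span ℝ {(θ : Space n)})ᗮ

lemma norm_coe_sph (θ : Sph n) : ‖(θ : Space n)‖ = 1 := mem_sphere_zero_iff_norm.1 θ.2

lemma inner_hyperplaneDir (θ : Sph n) (y : hyperplaneDir θ) :
    inner ℝ (y : Space n) (θ : Space n) = 0 :=
  Submodule.mem_orthogonal_singleton_iff_inner_left.1 y.2

lemma inner_smul_add_hyperplaneDir (θ : Sph n) (s : ℝ) (y : hyperplaneDir θ) :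
    inner ℝ (s • (θ : Space n) + y) (θ : Space n) = s := by
  rw [inner_add_left, inner_hyperplaneDir, inner_smul_left, real_inner_self_eq_norm_sq,
    norm_coe_sph]
  simp

lemma norm_le_norm_smul_add (θ : Sph n) (s : ℝ) (y : hyperplaneDir θ) :
    ‖(y : Space n)‖ ≤ ‖s • (θ : Space n) + y‖ := by
  have h := norm_add_sq_real (s • (θ : Space n)) (y : Space n)
  rw [inner_smul_left, real_inner_comm, inner_hyperplaneDir, mul_zero, mul_zero, add_zero] at h
  exact le_of_sq_le_sq (by nlinarith [sq_nonneg ‖s • (θ : Space n)‖]) (norm_nonneg _)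

lemma finrank_hyperplaneDir (θ : Sph n) : Module.finrank ℝ (hyperplaneDir θ) = n - 1 := by
  have h := (Submodule.span ℝ {(θ : Space n)}).finrank_add_finrank_orthogonal
  rw [finrank_span_singleton (ne_zero_of_mem_unit_sphere θ), finrank_euclideanSpace_fin] at h
  change 1 + Module.finrank ℝ (hyperplaneDir θ) = n at h
  omega

/-- The hyperplane is the isometric image of `θ^⊥` under translation by `sθ`, and on this
`(n-1)`-dimensional Euclidean space the normalised Hausdorff measure is the volume. -/
lemma radon_eq_integral (f : Space n → ℂ) (s : ℝ) (θ : Sph n) :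
    radon f s θ = ∫ y : hyperplaneDir θ, f (s • (θ : Space n) + y) := by
  have hiso : Isometry fun y : hyperplaneDir θ => s • (θ : Space n) + (y : Space n) :=
    (IsometryEquiv.addLeft (s • (θ : Space n))).isometry.comp isometry_subtype_coe
  have hrange : Set.range (fun y : hyperplaneDir θ => s • (θ : Space n) + (y : Space n)) =
      {z : Space n | inner ℝ z (θ : Space n) = s} := by
    ext z
    constructor
    · rintro ⟨y, rfl⟩
      exact inner_smul_add_hyperplaneDir θ s y
    · intro hz
      refine ⟨⟨z - s • (θ : Space n), ?_⟩, by simp⟩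
      rw [Submodule.mem_orthogonal_singleton_iff_inner_left, inner_sub_left, inner_smul_left,
        real_inner_self_eq_norm_sq, norm_coe_sph, hz]
      simp
  have hvol : (μHE[n - 1] : Measure (hyperplaneDir θ)) = volume := by
    rw [← finrank_hyperplaneDir θ]
    exact InnerProductSpace.euclideanHausdorffMeasure_eq_volume
  rw [radon, ← hrange, ← hiso.map_euclideanHausdorffMeasure, hvol,
    hiso.isClosedEmbedding.measurableEmbedding.integral_map]

lemma measurePreserving_smul_add (θ : Sph n) :
    MeasurePreserving fun p : ℝ × hyperplaneDir θ => p.1 • (θ : Space n) + (p.2 : Space n) := by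
  have h1 : MeasurePreserving (Prod.map
      (LinearIsometryEquiv.toSpanUnitSingleton (𝕜 := ℝ) (θ : Space n) (norm_coe_sph θ))
      (id : hyperplaneDir θ → hyperplaneDir θ)) :=
    (LinearIsometryEquiv.measurePreserving _).prod (MeasurePreserving.id _)
  have h2 := (WithLp.volume_preserving_toLp (Submodule.span ℝ {(θ : Space n)})
    (hyperplaneDir θ)).comp h1
  have h3 := (Submodule.orthogonalDecomposition
    (Submodule.span ℝ {(θ : Space n)})).symm.measurePreserving.comp h2
  convert h3 using 1
  funext p
  simp [Submodule.orthogonalDecomposition_symm_apply]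

/-- The character with frequency `σθ` is constant on each hyperplane `⟨z, θ⟩ = s`, so Fubini along
`ℝθ ⊕ θ^⊥` gives the slice theorem. -/
lemma fourier_radon {f : Space n → ℂ} (hf : Integrable f) (θ : Sph n)
    (σ : ℝ) : 𝓕 (fun s => radon f s θ) σ = 𝓕 f (σ • (θ : Space n)) := by
  have hmp := measurePreserving_smul_add θ
  have hF : Integrable fun z => Real.fourierChar (-inner ℝ z (σ • (θ : Space n))) • f z :=
    (Real.fourierIntegral_convergent_iff _).2 hf
  have hF' : Integrable (fun p : ℝ × hyperplaneDir θ => Real.fourierChar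
      (-inner ℝ (p.1 • (θ : Space n) + p.2) (σ • (θ : Space n))) •
        f (p.1 • (θ : Space n) + p.2)) (volume.prod volume) := (hmp.integrable_comp hF.1).2 hF
  rw [Real.fourier_eq, Real.fourier_eq, ← hmp.map_eq, integral_map hmp.measurable.aemeasurable
    (by rw [hmp.map_eq]; exact hF.1), Measure.volume_eq_prod, integral_prod _ hF']
  refine integral_congr_ae (.of_forall fun s => ?_)
  simp only [radon_eq_integral, Circle.smul_def]
  rw [← integral_smul]
  refine integral_congr_ae (.of_forall fun y => ?_)
  simp only [inner_smul_right, inner_smul_add_hyperplaneDir, RCLike.inner_apply, conj_trivial]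

lemma integrable_radon {f : Space n → ℂ} (hf : Integrable f) (θ : Sph n) :
    Integrable fun s => radon f s θ := by
  have hmp := measurePreserving_smul_add θ
  simp only [radon_eq_integral]
  exact ((hmp.integrable_comp hf.1).2 hf).integral_prod_left

lemma continuous_radon {f : Space n → ℂ} (hf : Continuous f) (hs : HasCompactSupport f)
    (θ : Sph n) : Continuous fun s => radon f s θ := by
  simp only [radon_eq_integral]
  obtain ⟨C, hC⟩ := hs.exists_bound_of_continuous hf
  obtain ⟨r, hr⟩ := hs.isCompact.isBounded.exists_norm_le
  refine continuous_of_dominated (bound := (closedBall (0 : hyperplaneDir θ) r).indicator fun _ => C)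
    (fun s => ?_) (fun s => .of_forall fun y => ?_) ?_ (.of_forall fun y => ?_)
  · exact (hf.comp (by fun_prop)).aestronglyMeasurable
  · by_cases hy : y ∈ closedBall (0 : hyperplaneDir θ) r
    · rw [Set.indicator_of_mem hy]
      exact hC _
    · rw [Set.indicator_of_notMem hy, image_eq_zero_of_notMem_tsupport (f := f), norm_zero]
      intro h
      refine hy (mem_closedBall_zero_iff.2 ((norm_le_norm_smul_add θ s y).trans (hr _ h)))
  · exact (integrable_indicator_iff measurableSet_closedBall).2
      (integrableOn_const (isCompact_closedBall _ _).measure_lt_top.ne)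
  · exact hf.comp (by fun_prop)

/-- Restriction of a Schwartz function to the line spanned by `θ`. -/
def lineRestrict (θ : Sph n) : 𝓢(Space n, ℂ) →L[ℂ] 𝓢(ℝ, ℂ) :=
  SchwartzMap.compCLMOfAntilipschitz ℂ (g := fun σ : ℝ => σ • (θ : Space n)) (K := 1)
    (ContinuousLinearMap.toSpanSingleton ℝ (θ : Space n)).hasTemperateGrowth
    ((isometry_iff_dist_eq.2 fun a b => by
      rw [dist_eq_norm, dist_eq_norm, ← sub_smul, norm_smul, norm_coe_sph, mul_one]).antilipschitz)

@[simp] lemma lineRestrict_apply (θ : Sph n) (f : 𝓢(Space n, ℂ)) (σ : ℝ) :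
    lineRestrict θ f σ = f (σ • (θ : Space n)) := rfl

/-- The Radon transform of a Schwartz function in the direction `θ`, via the Fourier slice
theorem. -/
def radonSchwartz (θ : Sph n) (f : 𝓢(Space n, ℂ)) : 𝓢(ℝ, ℂ) := 𝓕⁻ (lineRestrict θ (𝓕 f))

lemma radon_eq_radonSchwartz (f : Test n) (s : ℝ) (θ : Sph n) :
    radon f s θ = radonSchwartz θ (testToSchwartz f) s := by
  have hi : Integrable (f : Space n → ℂ) := f.continuous.integrable_of_hasCompactSupport
    f.hasCompactSupport
  have h1 : 𝓕 (fun s => radon f s θ) = ⇑(lineRestrict θ (𝓕 (testToSchwartz f))) :=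
    funext fun σ => fourier_radon hi θ σ
  have h2 := (continuous_radon f.continuous f.hasCompactSupport θ).fourierInv_fourier_eq
    (integrable_radon hi θ) (by rw [h1]; exact SchwartzMap.integrable _)
  rw [h1] at h2
  rw [radonSchwartz, SchwartzMap.fourierInv_coe, h2]

lemma coe_derivCLM_iterate (q : 𝓢(ℝ, ℂ)) (k : ℕ) :
    ⇑((SchwartzMap.derivCLM ℂ ℂ)^[k] q) = iteratedDeriv k q := by
  induction k with
  | zero => simp
  | succ k ih =>
    rw [Function.iterate_succ_apply', iteratedDeriv_succ, ← ih]
    funext x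
    exact SchwartzMap.derivCLM_apply _ _ _

lemma fourier_derivCLM_iterate (q : 𝓢(ℝ, ℂ)) (k : ℕ) (σ : ℝ) :
    𝓕 ((SchwartzMap.derivCLM ℂ ℂ)^[k] q) σ = (2 * Real.pi * Complex.I * σ) ^ k * 𝓕 q σ := by
  rw [SchwartzMap.fourier_coe, coe_derivCLM_iterate, Real.fourier_iteratedDeriv (N := ⊤)
    (q.smooth ⊤) (fun j _ => by rw [← coe_derivCLM_iterate]; exact SchwartzMap.integrable _) le_top]
  rfl

/-- The normalising constant of the Lax–Phillips transform. -/
def lpConst (n : ℕ) : ℂ := ((√2 * (2 * Real.pi) ^ ((n - 1) / 2) : ℝ) : ℂ)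

/-- The Lax–Phillips transform of Schwartz data in the direction `θ`. -/
def lpSchwartz (θ : Sph n) (p : 𝓢(Space n, ℂ) × 𝓢(Space n, ℂ)) : 𝓢(ℝ, ℂ) :=
  (lpConst n)⁻¹ • ((SchwartzMap.derivCLM ℂ ℂ)^[(n + 1) / 2] (radonSchwartz θ p.1)
    - (SchwartzMap.derivCLM ℂ ℂ)^[(n - 1) / 2] (radonSchwartz θ p.2))

/-- The Fourier transform in `s` of the Lax–Phillips transform. -/
def lpHat (p : 𝓢(Space n, ℂ) × 𝓢(Space n, ℂ)) (σ : ℝ) (θ : Sph n) : ℂ :=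
  (lpConst n)⁻¹ * (2 * Real.pi * Complex.I * σ) ^ ((n - 1) / 2) *
    (2 * Real.pi * Complex.I * σ * 𝓕 p.1 (σ • (θ : Space n)) - 𝓕 p.2 (σ • (θ : Space n)))

lemma fourier_lpSchwartz (hn : Odd n) (p : 𝓢(Space n, ℂ) × 𝓢(Space n, ℂ)) (σ : ℝ) (θ : Sph n) :
    𝓕 (lpSchwartz θ p) σ = lpHat p σ θ := by
  -- This lets the common power of `2πiσ` be factored out of both terms.
  have hm : (n + 1) / 2 = (n - 1) / 2 + 1 := by
    obtain ⟨k, rfl⟩ := hn; omega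
  have h (f : 𝓢(Space n, ℂ)) : 𝓕 (radonSchwartz θ f) σ = 𝓕 f (σ • (θ : Space n)) := by
    rw [radonSchwartz, FourierTransform.fourier_fourierInv_eq, lineRestrict_apply]
  rw [lpSchwartz, FourierTransform.fourier_smul, sub_eq_add_neg, FourierTransform.fourier_add,
    FourierTransform.fourier_neg]
  simp only [smul_apply, add_apply, neg_apply,
    fourier_derivCLM_iterate, h, hm, lpHat, smul_eq_mul]
  ring

/-- Cauchy data as a pair of Schwartz functions. -/
def dataToSchwartz (d : Data n) : 𝓢(Space n, ℂ) × 𝓢(Space n, ℂ) :=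
  (testToSchwartz d.1, testToSchwartz d.2)

lemma laxPhillips_eq_lpSchwartz (d : Data n) (s : ℝ) (θ : Sph n) :
    laxPhillips d s θ = lpSchwartz θ (dataToSchwartz d) s := by
  have h (f : Test n) : (fun σ => radon f σ θ) = radonSchwartz θ (testToSchwartz f) :=
    funext fun σ => radon_eq_radonSchwartz f σ θ
  rw [laxPhillips, h, h, ← coe_derivCLM_iterate, ← coe_derivCLM_iterate]
  rfl

lemma lpSchwartz_eq_fourierInv (hn : Odd n) (p : 𝓢(Space n, ℂ) × 𝓢(Space n, ℂ)) (s : ℝ)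
    (θ : Sph n) : lpSchwartz θ p s = ∫ σ : ℝ, Real.fourierChar (σ * s) • lpHat p σ θ := by
  have h1 : ⇑(𝓕 (lpSchwartz θ p) : 𝓢(ℝ, ℂ)) = fun σ => lpHat p σ θ :=
    funext fun σ => fourier_lpSchwartz hn p σ θ
  have h2 : lpSchwartz θ p = 𝓕⁻ (𝓕 (lpSchwartz θ p)) :=
    (FourierTransform.fourierInv_fourier_eq _).symm
  rw [h2, SchwartzMap.fourierInv_coe, h1, Real.fourierInv_eq]
  simp [mul_comm]

end RadonTransform

/-! ### The energy identity, by polar coordinates and Plancherel -/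

section Isometry

open scoped FourierTransform SchwartzMap ENNReal LineDeriv

variable {n : ℕ}

/-- Surface measure on the sphere. -/
abbrev sphMeasure (n : ℕ) : Measure (Sph n) := (volume : Measure (Space n)).toSphere

lemma lintegral_polar (hn : n ≠ 0) {F : Space n → ℝ≥0∞} (hF : Measurable F) :
    ∫⁻ x, F x = ∫⁻ θ : Sph n, (∫⁻ r in Set.Ioi (0 : ℝ), ENNReal.ofReal (r ^ (n - 1)) *
      F (r • (θ : Space n))) ∂sphMeasure n := by
  have : Nonempty (Fin n) := ⟨⟨0, Nat.pos_of_ne_zero hn⟩⟩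
  have hmp := (volume : Measure (Space n)).measurePreserving_homeomorphUnitSphereProd
  rw [finrank_euclideanSpace_fin] at hmp
  have hG : Measurable fun q : Sph n × Set.Ioi (0 : ℝ) => F ((q.2 : ℝ) • (q.1 : Space n)) :=
    hF.comp (by fun_prop)
  have hdens : Measurable fun r : Set.Ioi (0 : ℝ) => ENNReal.ofReal ((r : ℝ) ^ (n - 1)) := by
    fun_prop
  calc ∫⁻ x, F x = ∫⁻ x in {0}ᶜ, F x := by rw [restrict_compl_singleton]
    _ = ∫⁻ x : ({0}ᶜ : Set (Space n)), F x ∂(volume.comap Subtype.val) :=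
        (lintegral_subtype_comap (measurableSet_singleton _).compl F).symm
    _ = ∫⁻ x : ({0}ᶜ : Set (Space n)), (fun q : Sph n × Set.Ioi (0 : ℝ) =>
          F ((q.2 : ℝ) • (q.1 : Space n))) (homeomorphUnitSphereProd (Space n) x)
          ∂(volume.comap Subtype.val) := by
        refine lintegral_congr fun x => ?_
        beta_reduce
        rw [← homeomorphUnitSphereProd_symm_apply_coe, Homeomorph.symm_apply_apply]
    _ = ∫⁻ q, F ((q.2 : ℝ) • (q.1 : Space n))
          ∂((sphMeasure n).prod (Measure.volumeIoiPow (n - 1))) :=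
        hmp.lintegral_comp_emb (Homeomorph.measurableEmbedding _)
          (fun q : Sph n × Set.Ioi (0 : ℝ) => F ((q.2 : ℝ) • (q.1 : Space n)))
    _ = ∫⁻ θ : Sph n, (∫⁻ r, F ((r : ℝ) • (θ : Space n)) ∂(Measure.volumeIoiPow (n - 1)))
          ∂sphMeasure n :=
        lintegral_prod _ hG.aemeasurable
    _ = _ := by
        refine lintegral_congr fun θ => ?_
        have hθ : Measurable fun r : Set.Ioi (0 : ℝ) => F ((r : ℝ) • (θ : Space n)) :=
          hF.comp (by fun_prop)
        rw [Measure.volumeIoiPow, lintegral_withDensity_eq_lintegral_mul _ hdens hθ]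
        exact lintegral_subtype_comap measurableSet_Ioi
          fun r : ℝ => ENNReal.ofReal (r ^ (n - 1)) * F (r • (θ : Space n))

lemma lintegral_eq_Ioi_add_Ioi {F : ℝ → ℝ≥0∞} :
    ∫⁻ σ, F σ = (∫⁻ r in Set.Ioi (0 : ℝ), F r) + ∫⁻ r in Set.Ioi (0 : ℝ), F (-r) := by
  rw [← lintegral_add_compl F measurableSet_Ioi, Set.compl_Ioi]
  congr 1
  have h := (Measure.measurePreserving_neg (volume : Measure ℝ)).setLIntegral_comp_emb
    (Homeomorph.neg ℝ).measurableEmbedding F (Set.Ioi 0)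
  rw [h, Set.image_neg_Ioi, neg_zero, setLIntegral_congr Iio_ae_eq_Iic]

/-- The energy of a pair of Schwartz functions. -/
def schwartzEnergy (p : 𝓢(Space n, ℂ) × 𝓢(Space n, ℂ)) : ℝ :=
  (∑ i, ∫ x, ‖fderiv ℝ p.1 x (EuclideanSpace.single i 1)‖ ^ 2) + ∫ x, ‖p.2 x‖ ^ 2

lemma integrable_norm_sq {E : Type*} [NormedAddCommGroup E] [NormedSpace ℝ E] [MeasurableSpace E]
    [BorelSpace E] [SecondCountableTopology E] {μ : Measure E} [μ.HasTemperateGrowth]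
    (f : 𝓢(E, ℂ)) : Integrable (fun x => ‖f x‖ ^ 2) μ :=
  (f.memLp 2 μ).integrable_norm_pow two_ne_zero

lemma lintegral_enorm_sq_schwartz {E : Type*} [NormedAddCommGroup E] [NormedSpace ℝ E]
    [MeasurableSpace E] [BorelSpace E] [SecondCountableTopology E] {μ : Measure E}
    [μ.HasTemperateGrowth] (f : 𝓢(E, ℂ)) :
    ∫⁻ x, ‖f x‖ₑ ^ 2 ∂μ = ENNReal.ofReal (∫ x, ‖f x‖ ^ 2 ∂μ) := by
  rw [ofReal_integral_eq_lintegral_ofReal (integrable_norm_sq f) (.of_forall fun x => by positivity)]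
  refine lintegral_congr fun x => ?_
  rw [← ofReal_norm, ENNReal.ofReal_pow (norm_nonneg _)]

lemma norm_sq_lpConst (n : ℕ) : ‖lpConst n‖ ^ 2 = 2 * ((2 * Real.pi) ^ ((n - 1) / 2)) ^ 2 := by
  rw [lpConst, Complex.norm_real, Real.norm_of_nonneg (by positivity), mul_pow,
    Real.sq_sqrt (by norm_num)]

lemma lpConst_ne_zero (n : ℕ) : lpConst n ≠ 0 := by
  unfold lpConst
  exact_mod_cast (by positivity : √2 * (2 * Real.pi) ^ ((n - 1) / 2) ≠ 0)

/-- For odd `n` twice the exponent `(n-1)/2` is exactly `n - 1`, the power in the polar Jacobian.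
The powers of `2π` cancel against the normalising constant, and its `√2` leaves the factor one half.
-/
lemma norm_sq_lpHat (hn : Odd n) (p : 𝓢(Space n, ℂ) × 𝓢(Space n, ℂ)) (σ : ℝ) (θ : Sph n) :
    ‖lpHat p σ θ‖ ^ 2 = |σ| ^ (n - 1) * (‖2 * Real.pi * Complex.I * σ * 𝓕 p.1 (σ • (θ : Space n))
      - 𝓕 p.2 (σ • (θ : Space n))‖ ^ 2 / 2) := by
  have hm : n - 1 = 2 * ((n - 1) / 2) := by obtain ⟨k, rfl⟩ := hn; omega
  have h1 : ‖(2 * Real.pi * Complex.I * σ : ℂ)‖ = 2 * Real.pi * |σ| := by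
    simp [abs_of_pos Real.pi_pos]
  have h2 : |σ| ^ (n - 1) = (|σ| ^ ((n - 1) / 2)) ^ 2 := by rw [← pow_mul, mul_comm, ← hm]
  rw [lpHat, norm_mul, norm_mul, norm_inv, norm_pow, h1, mul_pow, mul_pow, inv_pow,
    norm_sq_lpConst, h2, mul_pow (2 * Real.pi)]
  have : (2 * Real.pi) ^ ((n - 1) / 2) ≠ 0 := by positivity
  generalize (2 * Real.pi) ^ ((n - 1) / 2) = P at this
  field_simp

lemma norm_sq_fourier_fderiv (f : 𝓢(Space n, ℂ)) :
    ∑ i, ∫ x, ‖fderiv ℝ f x (EuclideanSpace.single i 1)‖ ^ 2 =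
      ∫ ξ, (2 * Real.pi * ‖ξ‖) ^ 2 * ‖𝓕 f ξ‖ ^ 2 := by
  have h1 (i : Fin n) (ξ : Space n) : ‖𝓕 (∂_{EuclideanSpace.single i (1 : ℝ)} f) ξ‖ ^ 2 =
      (2 * Real.pi) ^ 2 * (ξ i ^ 2 * ‖𝓕 f ξ‖ ^ 2) := by
    rw [SchwartzMap.fourier_lineDerivOp_eq, smul_apply, SchwartzMap.smulLeftCLM_apply_apply
      (by fun_prop), norm_smul, norm_smul]
    simp only [EuclideanSpace.inner_single_right, conj_trivial, one_mul, norm_mul, Complex.norm_I,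
      mul_one, Complex.norm_ofNat, Complex.norm_real, Real.norm_eq_abs, abs_of_pos Real.pi_pos,
      mul_pow, sq_abs]
  have h2 (i : Fin n) : ∫ x, ‖fderiv ℝ f x (EuclideanSpace.single i 1)‖ ^ 2 =
      ∫ ξ, (2 * Real.pi) ^ 2 * (ξ i ^ 2 * ‖𝓕 f ξ‖ ^ 2) := by
    have h := SchwartzMap.integral_norm_sq_fourier (∂_{EuclideanSpace.single i (1 : ℝ)} f)
    simp only [h1] at h
    rw [h]
    simp only [SchwartzMap.lineDerivOp_apply_eq_fderiv]
  simp only [h2]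
  rw [← integral_finsetSum]
  · refine integral_congr_ae (.of_forall fun ξ => ?_)
    beta_reduce
    rw [← Finset.mul_sum, ← Finset.sum_mul, ← EuclideanSpace.real_norm_sq_eq]
    ring
  · intro i _
    simp only [← h1]
    exact integrable_norm_sq _

lemma integrable_norm_mul_sq (f : 𝓢(Space n, ℂ)) :
    Integrable fun ξ : Space n => (2 * Real.pi * ‖ξ‖) ^ 2 * ‖f ξ‖ ^ 2 := by
  have h1 : ∀ ξ, ‖f ξ‖ ≤ (SchwartzMap.seminorm ℝ 0 0) f := f.norm_le_seminorm ℝ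
  refine (((f.integrable_pow_mul volume 2).const_mul
    ((2 * Real.pi) ^ 2 * (SchwartzMap.seminorm ℝ 0 0) f))).mono' ?_ (.of_forall fun ξ => ?_)
  · have := f.continuous
    exact Continuous.aestronglyMeasurable (by fun_prop)
  · rw [Real.norm_of_nonneg (by positivity)]
    calc (2 * Real.pi * ‖ξ‖) ^ 2 * ‖f ξ‖ ^ 2
        = (2 * Real.pi) ^ 2 * ‖f ξ‖ * (‖ξ‖ ^ 2 * ‖f ξ‖) := by ring
      _ ≤ _ := by gcongr; exact h1 ξ

lemma schwartzEnergy_eq_fourier (p : 𝓢(Space n, ℂ) × 𝓢(Space n, ℂ)) : schwartzEnergy p =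
    ∫ ξ, ((2 * Real.pi * ‖ξ‖) ^ 2 * ‖𝓕 p.1 ξ‖ ^ 2 + ‖𝓕 p.2 ξ‖ ^ 2) := by
  rw [schwartzEnergy, norm_sq_fourier_fderiv, ← SchwartzMap.integral_norm_sq_fourier p.2,
    ← integral_add (integrable_norm_mul_sq _) (integrable_norm_sq _)]

/-- The half-lines `σ > 0` and `σ < 0` each give a full integral over `ℝⁿ` in polar coordinates.
After reflecting the second, their integrands at `ξ` are half of `|2πi|ξ|φ̂ - ψ̂|²` and half of
`|2πi|ξ|φ̂ + ψ̂|²`. -/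
lemma lintegral_lpHat (hn : Odd n) (p : 𝓢(Space n, ℂ) × 𝓢(Space n, ℂ)) :
    ∫⁻ θ : Sph n, (∫⁻ σ : ℝ, ‖lpHat p σ θ‖ₑ ^ 2) ∂sphMeasure n = ENNReal.ofReal (schwartzEnergy p) := by
  have hf := (𝓕 p.1 : 𝓢(Space n, ℂ)).continuous
  have hg := (𝓕 p.2 : 𝓢(Space n, ℂ)).continuous
  have hn0 : n ≠ 0 := by rintro rfl; exact absurd hn (by decide)
  -- For `ε = ±1` this is the squared transform without its Jacobian, at `σ = ε|ξ|` and `θ = ξ/|ξ|`.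
  set A : ℝ → Space n → ℝ := fun ε ξ =>
    ‖2 * Real.pi * Complex.I * (ε * ‖ξ‖ : ℝ) * 𝓕 p.1 (ε • ξ) - 𝓕 p.2 (ε • ξ)‖ ^ 2 / 2 with hA
  have hAc (ε : ℝ) : Continuous (A ε) := by
    have h1 : Continuous fun ξ : Space n => 𝓕 p.1 (ε • ξ) := hf.comp (by fun_prop)
    have h2 : Continuous fun ξ : Space n => 𝓕 p.2 (ε • ξ) := hg.comp (by fun_prop)
    fun_prop
  have hAm (ε : ℝ) : Measurable fun ξ => ENNReal.ofReal (A ε ξ) :=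
    (hAc ε).measurable.ennreal_ofReal
  have hpt (ε : ℝ) (hε : |ε| = 1) (θ : Sph n) (r : ℝ) (hr : r ∈ Set.Ioi (0 : ℝ)) :
      ‖lpHat p (ε * r) θ‖ₑ ^ 2 =
        ENNReal.ofReal (r ^ (n - 1)) * ENNReal.ofReal (A ε (r • (θ : Space n))) := by
    have hr' : 0 < r := hr
    rw [← ENNReal.ofReal_mul (by positivity), ← ofReal_norm, ← ENNReal.ofReal_pow (norm_nonneg _),
      norm_sq_lpHat hn, abs_mul, hε, one_mul, abs_of_pos hr']
    simp only [hA, norm_smul, norm_coe_sph, mul_one, Real.norm_eq_abs, abs_of_pos hr', smul_smul]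
  have hsplit (θ : Sph n) : ∫⁻ σ : ℝ, ‖lpHat p σ θ‖ₑ ^ 2 =
      (∫⁻ r in Set.Ioi (0 : ℝ), ENNReal.ofReal (r ^ (n - 1)) *
        ENNReal.ofReal (A 1 (r • (θ : Space n)))) +
      ∫⁻ r in Set.Ioi (0 : ℝ), ENNReal.ofReal (r ^ (n - 1)) *
        ENNReal.ofReal (A (-1) (r • (θ : Space n))) := by
    rw [lintegral_eq_Ioi_add_Ioi]
    congr 1
    · exact setLIntegral_congr_fun measurableSet_Ioi fun r hr => by
        rw [← hpt 1 (by simp) θ r hr, one_mul]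
    · exact setLIntegral_congr_fun measurableSet_Ioi fun r hr => by
        rw [← hpt (-1) (by simp) θ r hr, neg_one_mul]
  have hmeas (ε : ℝ) : Measurable fun θ : Sph n => ∫⁻ r in Set.Ioi (0 : ℝ),
      ENNReal.ofReal (r ^ (n - 1)) * ENNReal.ofReal (A ε (r • (θ : Space n))) := by
    refine Measurable.lintegral_prod_right' (f := fun q : Sph n × ℝ =>
      ENNReal.ofReal (q.2 ^ (n - 1)) * ENNReal.ofReal (A ε (q.2 • (q.1 : Space n)))) ?_
    have := hAc ε
    fun_prop
  simp only [hsplit]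
  rw [lintegral_add_left (hmeas 1), ← lintegral_polar hn0 (hAm 1), ← lintegral_polar hn0 (hAm (-1)),
    ← (Measure.measurePreserving_neg (volume : Measure (Space n))).lintegral_comp (hAm (-1)),
    ← lintegral_add_left (hAm 1), schwartzEnergy_eq_fourier, ofReal_integral_eq_lintegral_ofReal
      (f := fun ξ => (2 * Real.pi * ‖ξ‖) ^ 2 * ‖𝓕 p.1 ξ‖ ^ 2 + ‖𝓕 p.2 ξ‖ ^ 2)
      ((integrable_norm_mul_sq _).add (integrable_norm_sq _)) (.of_forall fun ξ => by positivity)]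
  refine lintegral_congr fun ξ => ?_
  rw [← ENNReal.ofReal_add (by positivity) (by positivity)]
  congr 1
  simp only [hA, one_smul, neg_smul, smul_neg, neg_neg, norm_neg, one_mul, neg_mul]
  set a := 𝓕 p.1 ξ
  set b := 𝓕 p.2 ξ
  -- The cross terms of the two antipodal contributions cancel.
  have h1 := parallelogram_law_with_norm ℂ (2 * Real.pi * Complex.I * ‖ξ‖ * a) b
  have h2 : ‖2 * Real.pi * Complex.I * ‖ξ‖ * a‖ ^ 2 = (2 * Real.pi * ‖ξ‖) ^ 2 * ‖a‖ ^ 2 := by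
    simp only [norm_mul, Complex.norm_I, mul_one, Complex.norm_ofNat, Complex.norm_real,
      Real.norm_eq_abs, abs_of_pos Real.pi_pos, abs_norm, mul_pow]
  have h3 : ‖2 * Real.pi * Complex.I * ((-‖ξ‖ : ℝ) : ℂ) * a - b‖ =
      ‖2 * Real.pi * Complex.I * ‖ξ‖ * a + b‖ := by
    rw [← norm_neg]
    congr 1
    push_cast
    ring
  rw [h3, ← h2]
  linarith

lemma exists_pow_mul_norm_le (f : 𝓢(Space n, ℂ)) (k : ℕ) :
    ∃ C : ℝ, ∀ x, ‖x‖ ^ k * ‖f x‖ ≤ C * (1 + ‖x‖ ^ 2)⁻¹ := by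
  obtain ⟨C, _, hC⟩ := f.decay k 0
  obtain ⟨D, _, hD⟩ := f.decay (k + 2) 0
  refine ⟨C + D, fun x => ?_⟩
  have h1 := hC x
  have h2 := hD x
  rw [norm_iteratedFDeriv_zero] at h1 h2
  rw [← div_eq_mul_inv, le_div_iff₀ (by positivity)]
  rw [pow_add] at h2
  nlinarith

/-- An integrable majorant uniform in `θ`. It makes the inverse Fourier transform jointly continuous
in `(s, θ)`, as needed for Tonelli and for a continuous curve in `L²(S^{n-1})`. -/
lemma exists_lpHat_bound (p : 𝓢(Space n, ℂ) × 𝓢(Space n, ℂ)) :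
    ∃ C : ℝ, ∀ σ (θ : Sph n), ‖lpHat p σ θ‖ ≤ C * (1 + σ ^ 2)⁻¹ := by
  obtain ⟨C, hC⟩ := exists_pow_mul_norm_le (𝓕 p.1) ((n - 1) / 2 + 1)
  obtain ⟨D, hD⟩ := exists_pow_mul_norm_le (𝓕 p.2) ((n - 1) / 2)
  set K := ‖(lpConst n)⁻¹‖ with hK
  set m := (n - 1) / 2
  refine ⟨K * (2 * Real.pi) ^ m * (2 * Real.pi * C + D), fun σ θ => ?_⟩
  have h1 := hC (σ • (θ : Space n))
  have h2 := hD (σ • (θ : Space n))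
  have h3 : ‖σ • (θ : Space n)‖ = |σ| := by rw [norm_smul, norm_coe_sph, mul_one, Real.norm_eq_abs]
  have h4 : ‖(2 * Real.pi * Complex.I * σ : ℂ)‖ = 2 * Real.pi * |σ| := by
    simp [abs_of_pos Real.pi_pos]
  rw [h3, sq_abs] at h1 h2
  rw [lpHat, norm_mul, norm_mul, norm_pow, h4, ← hK]
  calc K * (2 * Real.pi * |σ|) ^ m * ‖2 * Real.pi * Complex.I * σ * 𝓕 p.1 (σ • (θ : Space n))
        - 𝓕 p.2 (σ • (θ : Space n))‖
      ≤ K * (2 * Real.pi * |σ|) ^ m * (2 * Real.pi * |σ| * ‖𝓕 p.1 (σ • (θ : Space n))‖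
        + ‖𝓕 p.2 (σ • (θ : Space n))‖) := by
        gcongr
        refine (norm_sub_le _ _).trans_eq ?_
        rw [norm_mul, h4]
    _ = K * (2 * Real.pi) ^ m * (2 * Real.pi * (|σ| ^ (m + 1) * ‖𝓕 p.1 (σ • (θ : Space n))‖)
        + |σ| ^ m * ‖𝓕 p.2 (σ • (θ : Space n))‖) := by ring
    _ ≤ K * (2 * Real.pi) ^ m * (2 * Real.pi * (C * (1 + σ ^ 2)⁻¹) + D * (1 + σ ^ 2)⁻¹) := by
        gcongr
    _ = _ := by ring

lemma continuous_lpHat (p : 𝓢(Space n, ℂ) × 𝓢(Space n, ℂ)) :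
    Continuous fun q : ℝ × Sph n => lpHat p q.1 q.2 := by
  have hf := (𝓕 p.1 : 𝓢(Space n, ℂ)).continuous
  have hg := (𝓕 p.2 : 𝓢(Space n, ℂ)).continuous
  unfold lpHat
  fun_prop

lemma continuous_integral_fourierChar_mul {X : Type*} [TopologicalSpace X]
    [FirstCountableTopology X] {g : ℝ × X → ℂ} (hg : Continuous g) {b : ℝ → ℝ}
    (hb : Integrable b) (hgb : ∀ σ x, ‖g (σ, x)‖ ≤ b σ) :
    Continuous fun q : ℝ × X => ∫ σ : ℝ, (Real.fourierChar (σ * q.1) : ℂ) * g (σ, q.2) := by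
  have h0 : Continuous fun s : ℝ => (Real.fourierChar s : ℂ) :=
    by
    have := Real.continuous_fourierChar
    fun_prop
  refine continuous_of_dominated (bound := b) (fun q => Continuous.aestronglyMeasurable ?_)
    (fun q => .of_forall fun σ => ?_) hb (.of_forall fun σ => ?_)
  · exact (h0.comp (continuous_id.mul continuous_const)).mul
      (hg.comp (continuous_id.prodMk continuous_const))
  · rw [norm_mul, Circle.norm_coe, one_mul]
    exact hgb σ q.2
  · exact (h0.comp (continuous_const.mul continuous_fst)).mul
      (hg.comp (continuous_const.prodMk continuous_snd))

lemma continuous_lpSchwartz (hn : Odd n) (p : 𝓢(Space n, ℂ) × 𝓢(Space n, ℂ)) :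
    Continuous fun q : ℝ × Sph n => lpSchwartz q.2 p q.1 := by
  obtain ⟨C, hC⟩ := exists_lpHat_bound p
  have h := continuous_integral_fourierChar_mul (continuous_lpHat p)
    (integrable_inv_one_add_sq.const_mul C) hC
  refine h.congr fun q => ?_
  rw [lpSchwartz_eq_fourierInv hn]
  rfl

lemma lintegral_lpSchwartz (hn : Odd n) (p : 𝓢(Space n, ℂ) × 𝓢(Space n, ℂ)) :
    ∫⁻ s : ℝ, ∫⁻ θ, ‖lpSchwartz θ p s‖ₑ ^ 2 ∂sphMeasure n = ENNReal.ofReal (schwartzEnergy p) := by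
  have hc := continuous_lpSchwartz hn p
  rw [lintegral_lintegral_swap (f := fun (s : ℝ) (θ : Sph n) => ‖lpSchwartz θ p s‖ₑ ^ 2)
    (Continuous.measurable (by unfold Function.uncurry; fun_prop)).aemeasurable,
    ← lintegral_lpHat hn]
  refine lintegral_congr fun θ => ?_
  rw [lintegral_enorm_sq_schwartz, ← SchwartzMap.integral_norm_sq_fourier,
    ← lintegral_enorm_sq_schwartz]
  simp only [fourier_lpSchwartz hn]

end Isometry

/-! ### The transform of Schwartz data as a map into `L²(ℝ; L²(S^{n-1}))` -/

section Transform

open scoped FourierTransform SchwartzMap ENNReal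

variable {n : ℕ}

lemma enorm_sq_eq_lintegral {α E : Type*} [MeasurableSpace α] [NormedAddCommGroup E]
    {μ : Measure α} (f : Lp E 2 μ) : ‖f‖ₑ ^ 2 = ∫⁻ x, ‖f x‖ₑ ^ 2 ∂μ := by
  rw [Lp.enorm_def, eLpNorm_eq_lintegral_rpow_enorm_toReal two_ne_zero ENNReal.ofNat_ne_top,
    ← ENNReal.rpow_natCast, ← ENNReal.rpow_mul]
  simp

lemma radonSchwartz_add (θ : Sph n) (f g : 𝓢(Space n, ℂ)) :
    radonSchwartz θ (f + g) = radonSchwartz θ f + radonSchwartz θ g := by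
  simp only [radonSchwartz, FourierTransform.fourier_add, map_add,
    FourierTransform.fourierInv_add]

lemma radonSchwartz_smul (θ : Sph n) (c : ℂ) (f : 𝓢(Space n, ℂ)) :
    radonSchwartz θ (c • f) = c • radonSchwartz θ f := by
  simp only [radonSchwartz, FourierTransform.fourier_smul, map_smul,
    FourierTransform.fourierInv_smul]

lemma lpSchwartz_add (θ : Sph n) (p q : 𝓢(Space n, ℂ) × 𝓢(Space n, ℂ)) :
    lpSchwartz θ (p + q) = lpSchwartz θ p + lpSchwartz θ q := by
  simp only [lpSchwartz, Prod.fst_add, Prod.snd_add, radonSchwartz_add, iterate_map_add]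
  module

lemma lpSchwartz_smul (θ : Sph n) (c : ℂ) (p : 𝓢(Space n, ℂ) × 𝓢(Space n, ℂ)) :
    lpSchwartz θ (c • p) = c • lpSchwartz θ p := by
  have h (k : ℕ) (f : 𝓢(ℝ, ℂ)) : (SchwartzMap.derivCLM ℂ ℂ)^[k] (c • f) =
      c • (SchwartzMap.derivCLM ℂ ℂ)^[k] f :=
    (Function.Semiconj.iterate_right (f := fun f : 𝓢(ℝ, ℂ) => c • f)
      (fun f => (map_smul _ c f).symm) k f).symm
  simp only [lpSchwartz, Prod.smul_fst, Prod.smul_snd, radonSchwartz_smul, h]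
  module

/-- The Lax–Phillips transform at `s` as an element of `L²(S^{n-1})`. -/
def lpCurve (hn : Odd n) (p : 𝓢(Space n, ℂ) × 𝓢(Space n, ℂ)) (s : ℝ) : SphL2 n :=
  ContinuousMap.toLp 2 (sphMeasure n) ℂ
    (ContinuousMap.curry ⟨fun q : ℝ × Sph n => lpSchwartz q.2 p q.1, continuous_lpSchwartz hn p⟩ s)

lemma coeFn_lpCurve (hn : Odd n) (p : 𝓢(Space n, ℂ) × 𝓢(Space n, ℂ)) (s : ℝ) :
    lpCurve hn p s =ᵐ[sphMeasure n] fun θ => lpSchwartz θ p s :=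
  ContinuousMap.coeFn_toLp _ _

lemma continuous_lpCurve (hn : Odd n) (p : 𝓢(Space n, ℂ) × 𝓢(Space n, ℂ)) :
    Continuous (lpCurve hn p) :=
  (ContinuousMap.toLp 2 (sphMeasure n) ℂ).continuous.comp (ContinuousMap.continuous _)

lemma lintegral_lpCurve (hn : Odd n) (p : 𝓢(Space n, ℂ) × 𝓢(Space n, ℂ)) :
    ∫⁻ s, ‖lpCurve hn p s‖ₑ ^ 2 = ENNReal.ofReal (schwartzEnergy p) := by
  rw [← lintegral_lpSchwartz hn]
  refine lintegral_congr fun s => ?_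
  rw [enorm_sq_eq_lintegral]
  refine lintegral_congr_ae ?_
  filter_upwards [coeFn_lpCurve hn p s] with θ h
  rw [h]

lemma memLp_lpCurve (hn : Odd n) (p : 𝓢(Space n, ℂ) × 𝓢(Space n, ℂ)) :
    MemLp (lpCurve hn p) 2 := by
  refine ⟨(continuous_lpCurve hn p).aestronglyMeasurable, ?_⟩
  rw [eLpNorm_lt_top_iff_lintegral_rpow_enorm_lt_top two_ne_zero ENNReal.ofNat_ne_top]
  have h := lintegral_lpCurve hn p
  simp only [ENNReal.toReal_ofNat, ENNReal.rpow_ofNat]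
  exact h ▸ ENNReal.ofReal_lt_top

lemma lpCurve_add (hn : Odd n) (p q : 𝓢(Space n, ℂ) × 𝓢(Space n, ℂ)) :
    lpCurve hn (p + q) = lpCurve hn p + lpCurve hn q := by
  funext s
  rw [Pi.add_apply, lpCurve, lpCurve, lpCurve, ← map_add]
  congr 1
  ext θ
  simp [lpSchwartz_add]

lemma lpCurve_smul (hn : Odd n) (c : ℂ) (p : 𝓢(Space n, ℂ) × 𝓢(Space n, ℂ)) :
    lpCurve hn (c • p) = c • lpCurve hn p := by
  funext s
  rw [Pi.smul_apply, lpCurve, lpCurve, ← map_smul]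
  congr 1
  ext θ
  simp [lpSchwartz_smul]

/-- The Lax–Phillips transform of Schwartz data. -/
def lpTransform (hn : Odd n) : 𝓢(Space n, ℂ) × 𝓢(Space n, ℂ) →ₗ[ℂ] TransL2 n where
  toFun p := (memLp_lpCurve hn p).toLp
  map_add' p q := by
    rw [← MemLp.toLp_add]
    exact MemLp.toLp_congr _ _ (by rw [lpCurve_add])
  map_smul' c p := by
    rw [RingHom.id_apply, ← MemLp.toLp_const_smul]
    exact MemLp.toLp_congr _ _ (by rw [lpCurve_smul])

lemma coeFn_lpTransform (hn : Odd n) (p : 𝓢(Space n, ℂ) × 𝓢(Space n, ℂ)) :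
    lpTransform hn p =ᵐ[volume] lpCurve hn p :=
  (memLp_lpCurve hn p).coeFn_toLp

lemma schwartzEnergy_nonneg (p : 𝓢(Space n, ℂ) × 𝓢(Space n, ℂ)) : 0 ≤ schwartzEnergy p := by
  unfold schwartzEnergy
  positivity

lemma norm_sq_lpTransform (hn : Odd n) (p : 𝓢(Space n, ℂ) × 𝓢(Space n, ℂ)) :
    ‖lpTransform hn p‖ ^ 2 = schwartzEnergy p := by
  have h : ‖lpTransform hn p‖ₑ ^ 2 = ENNReal.ofReal (schwartzEnergy p) := by
    rw [enorm_sq_eq_lintegral, ← lintegral_lpCurve hn]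
    refine lintegral_congr_ae ?_
    filter_upwards [coeFn_lpTransform hn p] with s h
    rw [h]
  rw [← ofReal_norm, ← ENNReal.ofReal_pow (norm_nonneg _)] at h
  exact (ENNReal.ofReal_eq_ofReal_iff (sq_nonneg _) (schwartzEnergy_nonneg p)).1 h

lemma schwartzEnergy_dataToSchwartz (d : Data n) : schwartzEnergy (dataToSchwartz d) = ‖d‖ ^ 2 := by
  have h (i : Fin n) : Integrable fun z => ‖partialD i d.1 z‖ ^ 2 :=
    ((partialD_continuous i d.1).memLp_of_hasCompactSupport (p := 2)
      (partialD_hasCompactSupport i d.1)).integrable_norm_pow two_ne_zero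
  have h2 : Integrable fun z => ‖d.2 z‖ ^ 2 :=
    (d.2.continuous.memLp_of_hasCompactSupport (p := 2)
      d.2.hasCompactSupport).integrable_norm_pow two_ne_zero
  rw [data_norm_sq, integral_add (integrable_finsetSum _ fun i _ => h i) h2,
    integral_finsetSum _ fun i _ => h i]
  rfl

end Transform

/-! ### Approximating Schwartz data by test data in energy -/

section Cutoff

open scoped FourierTransform SchwartzMap ENNReal LineDeriv
open Filter Topology

variable {n : ℕ}

/-- A smooth cutoff function equal to one on the unit ball. -/
def unitBump (n : ℕ) : ContDiffBump (0 : Space n) := ⟨1, 2, one_pos, one_lt_two⟩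

/-- The cutoff function `χ(x / (k + 1))`. -/
def cutoff (n k : ℕ) (x : Space n) : ℝ := unitBump n (((k : ℝ) + 1)⁻¹ • x)

lemma contDiff_cutoff (k : ℕ) : ContDiff ℝ ∞ (cutoff n k) :=
  (unitBump n).contDiff.comp (contDiff_const_smul _)

lemma hasCompactSupport_cutoff (k : ℕ) : HasCompactSupport (cutoff n k) :=
  (unitBump n).hasCompactSupport.comp_smul (by positivity)

lemma cutoff_eventually_eq_one (x : Space n) : ∀ᶠ k in atTop, cutoff n k =ᶠ[𝓝 x] fun _ => 1 := by
  filter_upwards [eventually_gt_atTop ⌈‖x‖⌉₊] with k hk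
  have hx : ‖x‖ < k := (Nat.le_ceil _).trans_lt (by exact_mod_cast hk)
  filter_upwards [(continuous_norm.tendsto x).eventually (gt_mem_nhds hx)] with y hy
  refine (unitBump n).one_of_mem_closedBall ?_
  rw [mem_closedBall_zero_iff, norm_smul, norm_inv, Real.norm_of_nonneg (by positivity)]
  change _ ≤ (1 : ℝ)
  rw [inv_mul_le_iff₀ (by positivity)]
  linarith

lemma cutoff_mem_Icc (k : ℕ) (x : Space n) : cutoff n k x ∈ Set.Icc 0 1 :=
  ⟨(unitBump n).nonneg, (unitBump n).le_one⟩

lemma exists_norm_fderiv_cutoff_le (n : ℕ) :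
    ∃ C : ℝ, ∀ k x, ‖fderiv ℝ (cutoff n k) x‖ ≤ C := by
  have hχ : ContDiff ℝ ∞ (unitBump n) := (unitBump n).contDiff
  obtain ⟨C, hC⟩ := ((unitBump n).hasCompactSupport.fderiv (𝕜 := ℝ)).exists_bound_of_continuous
    (hχ.continuous_fderiv (by simp))
  refine ⟨C, fun k x => ?_⟩
  have h : HasFDerivAt (cutoff n k) (((k : ℝ) + 1)⁻¹ •
      fderiv ℝ (unitBump n) (((k : ℝ) + 1)⁻¹ • x)) x := by
    have h1 := (hχ.differentiable (by simp) (((k : ℝ) + 1)⁻¹ • x)).hasFDerivAt.comp x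
      ((hasFDerivAt_id x).const_smul ((k : ℝ) + 1)⁻¹)
    convert! h1 using 1
    ext v
    simp
  rw [h.fderiv, norm_smul, norm_inv, Real.norm_of_nonneg (by positivity)]
  have h2 : ((k : ℝ) + 1)⁻¹ ≤ 1 := inv_le_one_of_one_le₀ (by linarith [k.cast_nonneg (α := ℝ)])
  calc _ ≤ 1 * C := by gcongr; exact hC _
    _ = C := one_mul C

/-- Multiplication of a Schwartz function with a cutoff function. -/
def cutoffTest (k : ℕ) (f : 𝓢(Space n, ℂ)) : Test n :=
  ⟨fun x => cutoff n k x • f x, (contDiff_cutoff k).smul (f.smooth ⊤),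
    (hasCompactSupport_cutoff k).smul_right, by simp⟩

lemma sub_cutoffTest_apply (k : ℕ) (f : 𝓢(Space n, ℂ)) (x : Space n) :
    (f - testToSchwartz (cutoffTest k f)) x = (1 - cutoff n k x) • f x := by
  rw [sub_smul, one_smul]
  rfl

lemma tendsto_integral_norm_sq_zero {g : ℕ → Space n → ℂ} {b : Space n → ℝ}
    (hg : ∀ k, Continuous (g k)) (hb : Integrable b) (hgb : ∀ k x, ‖g k x‖ ^ 2 ≤ b x)
    (h0 : ∀ x, ∀ᶠ k in atTop, g k x = 0) :
    Tendsto (fun k => ∫ x, ‖g k x‖ ^ 2) atTop (𝓝 0) := by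
  rw [← integral_zero (Space n) ℝ]
  refine tendsto_integral_of_dominated_convergence b
    (fun k => ((hg k).norm.pow 2).aestronglyMeasurable) hb
    (fun k => .of_forall fun x => ?_) (.of_forall fun x => ?_)
  · rw [Real.norm_of_nonneg (by positivity)]
    exact hgb k x
  · refine tendsto_const_nhds.congr' ?_
    filter_upwards [h0 x] with k hk
    simp [hk]

lemma tendsto_integral_sub_cutoffTest (f : 𝓢(Space n, ℂ)) :
    Tendsto (fun k => ∫ x, ‖(f - testToSchwartz (cutoffTest k f)) x‖ ^ 2) atTop (𝓝 0) := by
  refine tendsto_integral_norm_sq_zero (fun k => SchwartzMap.continuous _)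
    (integrable_norm_sq f) (fun k x => ?_) fun x => ?_
  · have h := cutoff_mem_Icc k x
    rw [sub_cutoffTest_apply, norm_smul, mul_pow]
    refine mul_le_of_le_one_left (sq_nonneg _) (pow_le_one₀ (norm_nonneg _) ?_)
    rw [Real.norm_of_nonneg (by linarith [h.2])]
    linarith [h.1]
  · filter_upwards [cutoff_eventually_eq_one x] with k hk
    rw [sub_cutoffTest_apply, hk.eq_of_nhds, sub_self, zero_smul]

lemma integrable_norm_sq_fderiv (f : 𝓢(Space n, ℂ)) (v : Space n) :
    Integrable fun x => ‖fderiv ℝ f x v‖ ^ 2 :=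
  integrable_norm_sq (∂_{v} f)

/-- The gradients of the cutoffs need only a bound uniform in `k`: near each point the cutoff is
eventually one, so the derivative of the error is eventually zero there and dominated convergence
applies. -/
lemma tendsto_integral_fderiv_sub_cutoffTest (f : 𝓢(Space n, ℂ)) (v : Space n) :
    Tendsto (fun k => ∫ x, ‖fderiv ℝ (f - testToSchwartz (cutoffTest k f) : 𝓢(Space n, ℂ)) x v‖ ^ 2)
      atTop (𝓝 0) := by
  obtain ⟨C, hC⟩ := exists_norm_fderiv_cutoff_le n
  have hcoe (k : ℕ) : ⇑(f - testToSchwartz (cutoffTest k f)) =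
      fun x => (1 - cutoff n k x) • f x := funext fun x => sub_cutoffTest_apply k f x
  have hb : Integrable fun x => 2 * ‖fderiv ℝ f x v‖ ^ 2 + 2 * (C * ‖v‖) ^ 2 * ‖f x‖ ^ 2 :=
    ((integrable_norm_sq_fderiv f v).const_mul _).add ((integrable_norm_sq f).const_mul _)
  refine tendsto_integral_norm_sq_zero (fun k => ?_) hb (fun k x => ?_) fun x => ?_
  · exact (((f - testToSchwartz (cutoffTest k f)).smooth 1).continuous_fderiv one_ne_zero).clm_apply
      continuous_const
  · have h := cutoff_mem_Icc k x
    have h1 : DifferentiableAt ℝ (cutoff n k) x := (contDiff_cutoff k).differentiable (by simp) x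
    have h2 : HasFDerivAt (fun x => (1 - cutoff n k x) • f x) _ x :=
      (h1.hasFDerivAt.const_sub 1).smul (f.differentiable x).hasFDerivAt
    rw [hcoe, h2.fderiv]
    have h3 : ‖((1 - cutoff n k x) • fderiv ℝ f x + (-fderiv ℝ (cutoff n k) x).smulRight (f x)) v‖ ≤
        ‖fderiv ℝ f x v‖ + C * ‖v‖ * ‖f x‖ := by
      simp only [add_apply, smul_apply, ContinuousLinearMap.smulRight_apply,
        neg_apply, neg_smul]
      refine (norm_add_le _ _).trans (add_le_add ?_ ?_)
      · rw [norm_smul]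
        refine mul_le_of_le_one_left (norm_nonneg _) ?_
        rw [Real.norm_of_nonneg (by linarith [h.2])]
        linarith [h.1]
      · rw [norm_neg, norm_smul]
        gcongr
        exact (ContinuousLinearMap.le_opNorm _ _).trans (by gcongr; exact hC k x)
    calc _ ≤ (‖fderiv ℝ f x v‖ + C * ‖v‖ * ‖f x‖) ^ 2 := pow_le_pow_left₀ (norm_nonneg _) h3 2
      _ ≤ _ := by nlinarith [sq_nonneg (‖fderiv ℝ f x v‖ - C * ‖v‖ * ‖f x‖)]
  · filter_upwards [cutoff_eventually_eq_one x] with k hk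
    have h0 : ⇑(f - testToSchwartz (cutoffTest k f)) =ᶠ[𝓝 x] fun _ => 0 := by
      rw [hcoe]
      filter_upwards [hk] with y hy
      rw [hy, sub_self, zero_smul]
    rw [h0.fderiv_eq]
    simp

lemma tendsto_schwartzEnergy_cutoff (p : 𝓢(Space n, ℂ) × 𝓢(Space n, ℂ)) :
    Tendsto (fun k => schwartzEnergy
      (p - dataToSchwartz ((cutoffTest k p.1, cutoffTest k p.2) : Test n × Test n))) atTop (𝓝 0) := by
  have h := (tendsto_finsetSum Finset.univ fun i _ => tendsto_integral_fderiv_sub_cutoffTest p.1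
    (EuclideanSpace.single (i : Fin n) 1)).add (tendsto_integral_sub_cutoffTest p.2)
  simp only [Finset.sum_const_zero, add_zero] at h
  exact h

lemma lpTransform_mem_closure (hn : Odd n) (p : 𝓢(Space n, ℂ) × 𝓢(Space n, ℂ)) :
    lpTransform hn p ∈ closure (Set.range fun d : Data n => lpTransform hn (dataToSchwartz d)) := by
  refine mem_closure_of_tendsto (b := atTop) (f := fun k => lpTransform hn
    (dataToSchwartz ((cutoffTest k p.1, cutoffTest k p.2) : Test n × Test n))) ?_
    (.of_forall fun k => ⟨_, rfl⟩)
  rw [tendsto_iff_norm_sub_tendsto_zero]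
  have h := (tendsto_schwartzEnergy_cutoff p).sqrt
  rw [Real.sqrt_zero] at h
  refine h.congr fun k => ?_
  rw [← norm_sq_lpTransform hn, map_sub, Real.sqrt_sq (norm_nonneg _), norm_sub_rev]

end Cutoff

/-! ### Product functions in the range of the transform -/

section TensorProducts

open scoped FourierTransform SchwartzMap ENNReal
open Filter Topology

variable {n : ℕ}

/-- The function `g(|ξ|) H(ξ / |ξ|) + g(-|ξ|) H(-ξ / |ξ|)`. -/
def evenPolar (g : ℝ → ℝ) (H : Space n → ℂ) (ξ : Space n) : ℂ :=
  g ‖ξ‖ * H (‖ξ‖⁻¹ • ξ) + g (-‖ξ‖) * H (-(‖ξ‖⁻¹ • ξ))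

/-- The polar coordinates are singular only at the origin, near which the function vanishes because
`g` does. -/
lemma contDiff_evenPolar {g : ℝ → ℝ} {H : Space n → ℂ} (hg : ContDiff ℝ ∞ g)
    (hH : ContDiff ℝ ∞ H) (h0 : g =ᶠ[𝓝 0] 0) : ContDiff ℝ ∞ (evenPolar g H) := by
  refine contDiff_iff_contDiffAt.2 fun ξ => ?_
  by_cases hξ : ξ = 0
  · subst hξ
    have h1 : Tendsto (fun ξ : Space n => ‖ξ‖) (𝓝 0) (𝓝 0) := by
      simpa using (continuous_norm (E := Space n)).tendsto 0
    have h2 : Tendsto (fun ξ : Space n => -‖ξ‖) (𝓝 0) (𝓝 0) := by simpa using h1.neg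
    have h3 : evenPolar g H =ᶠ[𝓝 0] fun _ => 0 := by
      filter_upwards [h1.eventually h0, h2.eventually h0] with ξ h h'
      simp [evenPolar, h, h']
    exact contDiffAt_const.congr_of_eventuallyEq h3
  · have h1 : ContDiffAt ℝ ∞ (fun ξ : Space n => ‖ξ‖) ξ := contDiffAt_norm ℝ hξ
    have h2 : ContDiffAt ℝ ∞ (fun ξ : Space n => ‖ξ‖⁻¹ • ξ) ξ :=
      (h1.inv (norm_ne_zero_iff.2 hξ)).smul contDiffAt_id
    have h3 : ContDiff ℝ ∞ fun x : ℝ => ((g x : ℝ) : ℂ) := Complex.ofRealCLM.contDiff.comp hg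
    exact ((h3.contDiffAt.comp ξ h1).mul (hH.contDiffAt.comp ξ h2)).add
      ((h3.contDiffAt.comp ξ h1.neg).mul (hH.contDiffAt.comp ξ h2.neg))

lemma hasCompactSupport_evenPolar {g : ℝ → ℝ} (hg : HasCompactSupport g) (H : Space n → ℂ) :
    HasCompactSupport (evenPolar g H) := by
  obtain ⟨r, hr⟩ := hg.isCompact.isBounded.exists_norm_le
  refine HasCompactSupport.intro (isCompact_closedBall (0 : Space n) r) fun ξ hξ => ?_
  rw [mem_closedBall_zero_iff, not_le] at hξ
  have h (x : ℝ) (hx : |x| = ‖ξ‖) : g x = 0 := by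
    refine image_eq_zero_of_notMem_tsupport fun hx' => ?_
    have := hr x hx'
    rw [Real.norm_eq_abs, hx] at this
    linarith
  rw [evenPolar, h _ (abs_norm ξ), h _ (by rw [abs_neg, abs_norm])]
  simp

/-- Symmetrising under `(σ, θ) ↦ (-σ, -θ)` makes the right side a function of `σθ` alone, so the
formula holds for both signs of `σ`. -/
lemma evenPolar_smul {g : ℝ → ℝ} (H : Space n → ℂ) (h0 : g 0 = 0) (σ : ℝ) (θ : Sph n) :
    evenPolar g H (σ • (θ : Space n)) =
      g σ * H (θ : Space n) + g (-σ) * H (-(θ : Space n)) := by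
  have hσ : ‖σ • (θ : Space n)‖ = |σ| := by rw [norm_smul, norm_coe_sph, mul_one, Real.norm_eq_abs]
  rw [evenPolar, hσ, smul_smul]
  rcases lt_trichotomy σ 0 with h | rfl | h
  · rw [abs_of_neg h, inv_neg, neg_mul, inv_mul_cancel₀ h.ne, neg_smul, one_smul, neg_neg, neg_neg,
      add_comm]
  · simp [h0]
  · rw [abs_of_pos h, inv_mul_cancel₀ h.ne', one_smul]

/-- The function `c⁻¹ (2πiσ)^{(n+1)/2} g(σ)`, where `c` is the constant of the Lax–Phillips
transform. -/
def radialProfile (n : ℕ) (g : ℝ → ℝ) (σ : ℝ) : ℂ :=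
  (lpConst n)⁻¹ * (2 * Real.pi * Complex.I * σ) ^ ((n - 1) / 2 + 1) * g σ

lemma contDiff_radialProfile {g : ℝ → ℝ} (hg : ContDiff ℝ ∞ g) :
    ContDiff ℝ ∞ (radialProfile n g) := by
  have h1 : ContDiff ℝ ∞ fun x : ℝ => (x : ℂ) := Complex.ofRealCLM.contDiff
  have h3 : ContDiff ℝ ∞ fun x : ℝ => ((g x : ℝ) : ℂ) := h1.comp hg
  unfold radialProfile
  fun_prop

lemma hasCompactSupport_radialProfile {g : ℝ → ℝ} (hg : HasCompactSupport g) :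
    HasCompactSupport (radialProfile n g) :=
  (hg.comp_left (g := fun x : ℝ => (x : ℂ)) Complex.ofReal_zero).mul_left

lemma exists_lpHat_eq {g : ℝ → ℝ} {H : Space n → ℂ} (hg : ContDiff ℝ ∞ g)
    (hgc : HasCompactSupport g) (h0 : g =ᶠ[𝓝 0] 0) (hH : ContDiff ℝ ∞ H) :
    ∃ p : 𝓢(Space n, ℂ) × 𝓢(Space n, ℂ), ∀ σ (θ : Sph n),
      lpHat p σ θ = radialProfile n g σ * H θ := by
  have h0' : (fun x => x * g x) =ᶠ[𝓝 0] 0 := by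
    filter_upwards [h0] with x hx
    simp [hx]
  let a : 𝓢(Space n, ℂ) :=
    (hasCompactSupport_evenPolar hgc H).toSchwartzMap (contDiff_evenPolar hg hH h0)
  let b : 𝓢(Space n, ℂ) :=
    (hasCompactSupport_evenPolar (g := fun x => x * g x) hgc.mul_left H).toSchwartzMap
      (contDiff_evenPolar (contDiff_id.mul hg) hH h0')
  have ha (σ : ℝ) (θ : Sph n) : a (σ • (θ : Space n)) = _ := evenPolar_smul H h0.eq_of_nhds σ θ
  have hb (σ : ℝ) (θ : Sph n) : b (σ • (θ : Space n)) = _ :=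
    evenPolar_smul (g := fun x => x * g x) H h0'.eq_of_nhds σ θ
  -- Split `F = g(σ)H(θ)` into antipodally even and odd parts, with `F'` its antipodal reflection.
  -- Then `φ̂ = (F + F')/2` and `ψ̂ = -πiσ(F - F')` are functions of `σθ`, and `2πiσ φ̂ - ψ̂ = 2πiσ
  -- F`.
  refine ⟨(𝓕⁻ ((1 / 2 : ℂ) • a), 𝓕⁻ ((-(Real.pi * Complex.I) : ℂ) • b)), fun σ θ => ?_⟩
  rw [lpHat, FourierTransform.fourier_fourierInv_eq, FourierTransform.fourier_fourierInv_eq,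
    smul_apply, smul_apply, ha, hb, radialProfile, smul_eq_mul, smul_eq_mul]
  push_cast
  ring

/-- The continuous functions on the sphere which extend to smooth functions on `ℝⁿ`. -/
def smoothSphere (n : ℕ) : StarSubalgebra ℂ C(Sph n, ℂ) where
  carrier := {f | ∃ H : Space n → ℂ, ContDiff ℝ ∞ H ∧ ∀ θ : Sph n, f θ = H θ}
  mul_mem' := by
    rintro f g ⟨H, hH, hf⟩ ⟨K, hK, hg⟩
    exact ⟨_, hH.mul hK, fun θ => by rw [ContinuousMap.mul_apply, hf, hg]⟩
  add_mem' := by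
    rintro f g ⟨H, hH, hf⟩ ⟨K, hK, hg⟩
    exact ⟨_, hH.add hK, fun θ => by rw [ContinuousMap.add_apply, hf, hg]⟩
  algebraMap_mem' c := ⟨fun _ => c, contDiff_const, fun θ => rfl⟩
  star_mem' := by
    rintro f ⟨H, hH, hf⟩
    exact ⟨_, Complex.conjCLE.contDiff.comp hH, fun θ => by
      rw [ContinuousMap.star_apply, hf]; rfl⟩

/-- Stone–Weierstrass: the coordinate functions separate points. -/
lemma smoothSphere_dense (n : ℕ) : Dense (smoothSphere n : Set C(Sph n, ℂ)) := by
  have h : (smoothSphere n).SeparatesPoints := by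
    intro x y hxy
    obtain ⟨i, hi⟩ : ∃ i, (x : Space n) i ≠ (y : Space n) i := by
      by_contra! h
      exact hxy (Subtype.ext (PiLp.ext h))
    have hc : ContDiff ℝ ∞ fun z : Space n => ((z i : ℝ) : ℂ) :=
      Complex.ofRealCLM.contDiff.comp (contDiff_piLp_apply 2)
    refine ⟨_, ⟨⟨fun θ : Sph n => (((θ : Space n) i : ℝ) : ℂ),
      hc.continuous.comp continuous_subtype_val⟩, ⟨_, hc, fun θ => rfl⟩, rfl⟩, ?_⟩
    exact fun h => hi (Complex.ofReal_injective h)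
  have h2 := ContinuousMap.starSubalgebra_topologicalClosure_eq_top_of_separatesPoints _ h
  rw [dense_iff_closure_eq, ← StarSubalgebra.topologicalClosure_coe, h2]
  rfl

lemma dense_toLp_smoothSphere (n : ℕ) :
    Dense ((ContinuousMap.toLp 2 (sphMeasure n) ℂ : C(Sph n, ℂ) →L[ℂ] SphL2 n) ''
      (smoothSphere n : Set C(Sph n, ℂ))) :=
  (ContinuousMap.toLp_denseRange (p := 2) ℂ (sphMeasure n) ℂ ENNReal.ofNat_ne_top).dense_image
    (ContinuousLinearMap.continuous _) (smoothSphere_dense n)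

lemma exists_lpTransform_eq (hn : Odd n) {g : ℝ → ℝ} (hg : ContDiff ℝ ∞ g)
    (hgc : HasCompactSupport g) (h0 : g =ᶠ[𝓝 0] 0) {h : C(Sph n, ℂ)} (hh : h ∈ smoothSphere n) :
    ∃ p : 𝓢(Space n, ℂ) × 𝓢(Space n, ℂ), lpTransform hn p =ᵐ[volume] fun s =>
      (𝓕⁻ ((hasCompactSupport_radialProfile (n := n) hgc).toSchwartzMap
        (contDiff_radialProfile hg)) : 𝓢(ℝ, ℂ)) s • ContinuousMap.toLp 2 (sphMeasure n) ℂ h := by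
  obtain ⟨H, hH, hhH⟩ := hh
  obtain ⟨p, hp⟩ := exists_lpHat_eq hg hgc h0 hH
  refine ⟨p, (coeFn_lpTransform hn p).trans (.of_forall fun s => ?_)⟩
  set γ := (hasCompactSupport_radialProfile (n := n) hgc).toSchwartzMap (contDiff_radialProfile hg)
  have h1 (θ : Sph n) : lpSchwartz θ p = h θ • 𝓕⁻ γ := by
    have h2 : 𝓕 (lpSchwartz θ p) = h θ • γ := by
      ext σ
      rw [fourier_lpSchwartz hn, hp, smul_apply, smul_eq_mul, hhH, mul_comm]
      rfl
    have h3 : 𝓕⁻ (𝓕 (lpSchwartz θ p)) = lpSchwartz θ p :=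
      FourierTransform.fourierInv_fourier_eq _
    rw [← h3, h2, FourierTransform.fourierInv_smul]
  beta_reduce
  rw [lpCurve, ← map_smul]
  congr 1
  ext θ
  simp [h1, mul_comm]

end TensorProducts

/-! ### Density of the range -/

section DenseRange

open scoped FourierTransform SchwartzMap ENNReal
open Filter Topology

variable {n : ℕ}

/-- The conjugate of the factor `c⁻¹ (2πiσ)^{(n+1)/2}` of `radialProfile`. -/
def conjFactor (n : ℕ) (σ : ℝ) : ℂ :=
  (starRingEnd ℂ) ((lpConst n)⁻¹ * (2 * Real.pi * Complex.I * σ) ^ ((n - 1) / 2 + 1))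

lemma continuous_conjFactor (n : ℕ) : Continuous (conjFactor n) := by
  unfold conjFactor
  exact Complex.continuous_conj.comp (by fun_prop)

lemma conjFactor_ne_zero {σ : ℝ} (hσ : σ ≠ 0) : conjFactor n σ ≠ 0 := by
  rw [conjFactor, map_ne_zero]
  exact mul_ne_zero (inv_ne_zero (lpConst_ne_zero n))
    (pow_ne_zero _ (mul_ne_zero Complex.two_pi_I_ne_zero (Complex.ofReal_ne_zero.2 hσ)))

lemma conj_radialProfile (g : ℝ → ℝ) (σ : ℝ) :
    (starRingEnd ℂ) (radialProfile n g σ) = g σ • conjFactor n σ := by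
  rw [radialProfile, map_mul, Complex.conj_ofReal, mul_comm, Complex.real_smul]
  rfl

/-- The functions `g` run through all real test functions on `ℝ \ {0}`, where the factor
`(2πiσ)^((n+1)/2)` has no zero; the excluded point is null. -/
lemma eq_zero_of_inner_radialProfile {f : Lp ℂ 2 (volume : Measure ℝ)}
    (h : ∀ (g : ℝ → ℝ) (hg : ContDiff ℝ ∞ g) (hgc : HasCompactSupport g), g =ᶠ[𝓝 0] 0 →
      inner ℂ (((hasCompactSupport_radialProfile (n := n) hgc).toSchwartzMap
        (contDiff_radialProfile hg)).toLp 2) f = 0) : f = 0 := by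
  have hloc : LocallyIntegrable (fun σ => conjFactor n σ * f σ) :=
    ((Lp.memLp f).locallyIntegrable one_le_two).continuous_mul (continuous_conjFactor n)
  have h1 := IsOpen.ae_eq_zero_of_integral_contDiff_smul_eq_zero
    (isOpen_compl_singleton (x := (0 : ℝ))) (hloc.locallyIntegrableOn _) fun g hg hgc hs => by
      have h0 : g =ᶠ[𝓝 0] 0 := notMem_tsupport_iff_eventuallyEq.1 fun h0 => hs h0 rfl
      rw [← h g hg hgc h0, L2.inner_def]
      refine integral_congr_ae ?_
      filter_upwards [SchwartzMap.coeFn_toLp ((hasCompactSupport_radialProfile (n := n)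
        hgc).toSchwartzMap (contDiff_radialProfile hg)) 2 volume] with σ hσ
      have h2 : ((hasCompactSupport_radialProfile (n := n) hgc).toSchwartzMap
        (contDiff_radialProfile hg)) σ = radialProfile n g σ := rfl
      rw [hσ, h2, RCLike.inner_apply', conj_radialProfile, smul_mul_assoc]
  refine Lp.eq_zero_iff_ae_eq_zero.2 ?_
  filter_upwards [h1, compl_mem_ae_iff.2 (Real.volume_singleton (a := 0))] with σ hσ hσ0
  exact (mul_eq_zero.1 (hσ hσ0)).resolve_left (conjFactor_ne_zero hσ0)

/-- Pairing with a fixed `h` on the sphere leaves a scalar function in `L²(ℝ)`, and orthogonality to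
the products with `h` says that its Fourier transform is orthogonal to all radial profiles. -/
lemma inner_toLp_ae_eq_zero (hn : Odd n) {F : TransL2 n}
    (hF : ∀ p, inner ℂ (lpTransform hn p) F = 0) {h : C(Sph n, ℂ)} (hh : h ∈ smoothSphere n) :
    ∀ᵐ s, inner ℂ (ContinuousMap.toLp 2 (sphMeasure n) ℂ h) (F s) = 0 := by
  set u : SphL2 n := ContinuousMap.toLp 2 (sphMeasure n) ℂ h with hu
  set f : Lp ℂ 2 (volume : Measure ℝ) := (innerSL ℂ u).compLp F
  have hf : ∀ᵐ s, f s = inner ℂ u (F s) := (innerSL ℂ u).coeFn_compLp F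
  have h1 : 𝓕 f = 0 := by
    refine eq_zero_of_inner_radialProfile (n := n) fun g hg hgc h0 => ?_
    set γ := (hasCompactSupport_radialProfile (n := n) hgc).toSchwartzMap
      (contDiff_radialProfile hg)
    obtain ⟨p, hp⟩ := exists_lpTransform_eq hn hg hgc h0 hh
    -- Plancherel then moves the pairing from `σ` back to `s`, where the hypothesis on `F` applies.
    have h2 : γ.toLp 2 = 𝓕 ((𝓕⁻ γ).toLp 2 : Lp ℂ 2 (volume : Measure ℝ)) := by
      rw [SchwartzMap.toLp_fourier_eq, FourierTransform.fourier_fourierInv_eq]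
    rw [h2, Lp.inner_fourier_eq, ← hF p, L2.inner_def, L2.inner_def]
    refine integral_congr_ae ?_
    filter_upwards [hp, hf, SchwartzMap.coeFn_toLp (𝓕⁻ γ) 2 volume] with s h3 h4 h5
    rw [h3, h4, h5, inner_smul_left, RCLike.inner_apply']
  have h2 : f = 0 := by
    have h3 : 𝓕⁻ (𝓕 f) = f := FourierTransform.fourierInv_fourier_eq f
    rw [← h3, h1]
    exact (Lp.fourierTransformₗᵢ ℝ ℂ).symm.map_zero
  rw [h2] at hf
  filter_upwards [hf, Lp.coeFn_zero ℂ 2 (volume : Measure ℝ)] with s h3 h4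
  rw [← h3, h4]
  rfl

lemma eq_zero_of_inner_lpTransform (hn : Odd n) {F : TransL2 n}
    (hF : ∀ p, inner ℂ (lpTransform hn p) F = 0) : F = 0 := by
  have : TopologicalSpace.SeparableSpace (SphL2 n) :=
    (ContinuousMap.toLp_denseRange (p := 2) ℂ (sphMeasure n) ℂ
      ENNReal.ofNat_ne_top).separableSpace (ContinuousLinearMap.continuous _)
  have : SecondCountableTopology (SphL2 n) := secondCountable_of_separable _
  -- The exceptional null set depends on the function on the sphere, so only countably many may be
  -- used.
  obtain ⟨t, hts, htc, htd⟩ := (dense_toLp_smoothSphere n).exists_countable_dense_subset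
  refine Lp.eq_zero_iff_ae_eq_zero.2 ?_
  have h : ∀ᵐ s, ∀ u ∈ t, inner ℂ u (F s) = 0 := (ae_ball_iff htc).2 fun u hu => by
    obtain ⟨h, hh, rfl⟩ := hts hu
    exact inner_toLp_ae_eq_zero hn hF hh
  filter_upwards [h] with s hs
  exact htd.eq_zero_of_inner_right ℂ fun u hu => hs u hu

lemma dense_range_lpTransform (hn : Odd n) :
    Dense (Set.range fun d : Data n => lpTransform hn (dataToSchwartz d)) := by
  have h : (LinearMap.range (lpTransform hn)).topologicalClosure = ⊤ := by
    rw [Submodule.topologicalClosure_eq_top_iff, Submodule.eq_bot_iff]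
    exact fun F hF => eq_zero_of_inner_lpTransform hn fun p => hF _ ⟨p, rfl⟩
  have h2 : Dense (Set.range (lpTransform hn)) := by
    rw [dense_iff_closure_eq]
    exact congrArg (fun K : Submodule ℂ (TransL2 n) => (K : Set (TransL2 n))) h
  refine dense_closure.1 (h2.mono ?_)
  rintro _ ⟨p, rfl⟩
  exact lpTransform_mem_closure hn p

end DenseRange

/-! ### The evolution becomes translation -/

section Translation

open scoped FourierTransform SchwartzMap ENNReal
open Filter Topology

variable {n : ℕ}

/-- The wave chosen in the definition of `waveOnData` is `freeWave d` by uniqueness, and the default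
value zero never occurs. -/
lemma hasCauchyData_waveOnData (t : ℝ) (d : Data n) :
    HasCauchyData (freeWave d) t (waveOnData t d) := by
  have h : ∃ d' : Data n, ∃ u, IsFreeWave u ∧ HasCauchyData u 0 d ∧ HasCauchyData u t d' :=
    let ⟨d', hd'⟩ := (isFreeWave_freeWave d).exists_data t
    ⟨d', freeWave d, isFreeWave_freeWave d, hasCauchyData_freeWave d, hd'⟩
  obtain ⟨u, hu, hu0, hut⟩ := h.choose_spec
  rw [waveOnData, dif_pos h]
  rwa [(isFreeWave_freeWave d).unique hu (hasCauchyData_freeWave d) hu0]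

/-- The propagator acts on `(φ̂, ψ̂)` at `σθ` by a two by two matrix in `cos` and `sin` of `2πσt`.
The row vector `(2πiσ, -1)` is a left eigenvector of it. -/
lemma lpHat_of_hasCauchyData {d e : Data n} {t : ℝ} (he : HasCauchyData (freeWave d) t e) (σ : ℝ)
    (θ : Sph n) : lpHat (dataToSchwartz e) σ θ =
      Complex.exp (-(2 * Real.pi * σ * t : ℝ) * Complex.I) * lpHat (dataToSchwartz d) σ θ := by
  have hσ : ‖σ • (θ : Space n)‖ = |σ| := by rw [norm_smul, norm_coe_sph, mul_one, Real.norm_eq_abs]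
  -- All entries of the propagator are even in `|σ|`, so `|σ|` may be replaced by `σ`.
  have hcos : Real.cos (2 * Real.pi * t * |σ|) = Real.cos (2 * Real.pi * σ * t) := by
    rcases abs_choice σ with h | h <;> rw [h]
    · ring_nf
    · rw [← Real.cos_neg]; ring_nf
  have hsin : |σ| * Real.sin (2 * Real.pi * t * |σ|) = σ * Real.sin (2 * Real.pi * σ * t) := by
    rcases abs_choice σ with h | h <;> rw [h]
    · ring_nf
    · rw [mul_neg, Real.sin_neg]; ring_nf
  have hsine : 2 * Real.pi * σ * sineMult t (σ • (θ : Space n)) =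
      Real.sin (2 * Real.pi * σ * t) := by
    have h1 := two_pi_norm_mul_sineMult t (σ • (θ : Space n))
    rw [hσ] at h1
    rcases abs_choice σ with h | h <;> rw [h] at h1
    · rw [h1]; ring_nf
    · rw [mul_neg, mul_neg, Real.sin_neg] at h1
      rw [show 2 * Real.pi * σ * t = 2 * Real.pi * t * σ by ring]
      linarith
  have hsine' : (2 * Real.pi * σ * sineMult t (σ • (θ : Space n)) : ℂ) =
      (Real.sin (2 * Real.pi * σ * t) : ℂ) := by exact_mod_cast congrArg Complex.ofReal hsine
  have hexp : Complex.exp (-(2 * Real.pi * σ * t : ℝ) * Complex.I) =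
      (Real.cos (2 * Real.pi * σ * t) : ℂ) - (Real.sin (2 * Real.pi * σ * t) : ℂ) * Complex.I := by
    rw [Complex.exp_mul_I, Complex.cos_neg, Complex.sin_neg, Complex.ofReal_cos,
      Complex.ofReal_sin]
    ring
  have hsin' : 2 * Real.pi * |σ| * Real.sin (2 * Real.pi * t * |σ|) =
      2 * Real.pi * (σ * Real.sin (2 * Real.pi * σ * t)) := by rw [← hsin]; ring
  simp only [lpHat, dataToSchwartz]
  rw [fourier_data_fst he, fourier_data_snd he, waveHat, waveHatDeriv, hσ, hcos, hsin', hexp]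
  generalize 𝓕 (testToSchwartz d.1) (σ • (θ : Space n)) = a
  generalize 𝓕 (testToSchwartz d.2) (σ • (θ : Space n)) = b
  have hI := Complex.I_sq
  push_cast at hsine' ⊢
  linear_combination
    (lpConst n)⁻¹ * (2 * Real.pi * Complex.I * σ) ^ ((n - 1) / 2) * (Complex.I * b * hsine' +
      2 * Real.pi * σ * Complex.sin (2 * Real.pi * σ * t) * a * hI)

lemma lpSchwartz_waveOnData (hn : Odd n) (t : ℝ) (d : Data n) (θ : Sph n) (s : ℝ) :
    lpSchwartz θ (dataToSchwartz (waveOnData t d)) s =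
      lpSchwartz θ (dataToSchwartz d) (s - t) := by
  rw [lpSchwartz_eq_fourierInv hn, lpSchwartz_eq_fourierInv hn]
  refine integral_congr_ae (.of_forall fun σ => ?_)
  beta_reduce
  rw [lpHat_of_hasCauchyData (hasCauchyData_waveOnData t d), Circle.smul_def, Circle.smul_def,
    smul_eq_mul, smul_eq_mul, ← mul_assoc, Real.fourierChar_apply, Real.fourierChar_apply,
    ← Complex.exp_add]
  congr 2
  push_cast
  ring

lemma lpCurve_waveOnData (hn : Odd n) (t : ℝ) (d : Data n) (s : ℝ) :
    lpCurve hn (dataToSchwartz (waveOnData t d)) s = lpCurve hn (dataToSchwartz d) (s - t) := by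
  rw [lpCurve, lpCurve]
  congr 1
  ext θ
  exact lpSchwartz_waveOnData hn t d θ s

/-- Translation by `t` in `L²(ℝ; L²(S^{n-1}))`. -/
def translate (t : ℝ) : TransL2 n → TransL2 n :=
  Lp.compMeasurePreserving (fun s : ℝ => s - t) (measurePreserving_sub_right volume t)

lemma isometry_translate (t : ℝ) : Isometry (translate (n := n) t) :=
  Lp.isometry_compMeasurePreserving _

lemma coeFn_translate (t : ℝ) (F : TransL2 n) : translate t F =ᵐ[volume] fun s => F (s - t) :=
  Lp.coeFn_compMeasurePreserving F _

/-- The Lax–Phillips transform as an isometry on Cauchy data. -/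
def lpData (hn : Odd n) : Data n →ₗᵢ[ℂ] TransL2 n where
  toFun d := lpTransform hn (dataToSchwartz d)
  map_add' d e := map_add (lpTransform hn) (dataToSchwartz d) (dataToSchwartz e)
  map_smul' c d := map_smul (lpTransform hn) c (dataToSchwartz d)
  norm_map' d := by
    have h : ‖lpTransform hn (dataToSchwartz d)‖ ^ 2 = ‖d‖ ^ 2 := by
      rw [norm_sq_lpTransform, schwartzEnergy_dataToSchwartz]
    exact (pow_left_inj₀ (norm_nonneg _) (norm_nonneg _) two_ne_zero).1 h

lemma lpData_waveOnData (hn : Odd n) (t : ℝ) (d : Data n) :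
    lpData hn (waveOnData t d) = translate t (lpData hn d) := by
  have h : translate t (lpData hn d) =
      ((memLp_lpCurve hn (dataToSchwartz d)).comp_measurePreserving
        (measurePreserving_sub_right volume t)).toLp _ := rfl
  rw [h]
  exact MemLp.toLp_congr (memLp_lpCurve hn _) _ (.of_forall fun s => lpCurve_waveOnData hn t d s)

lemma coeFn_lpData (hn : Odd n) (d : Data n) :
    ∀ᵐ s, (lpData hn d s : Sph n → ℂ) =ᵐ[sphMeasure n] laxPhillips d s := by
  filter_upwards [coeFn_lpTransform hn (dataToSchwartz d)] with s hs
  change (lpTransform hn (dataToSchwartz d) s : Sph n → ℂ) =ᵐ[sphMeasure n] _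
  rw [hs]
  filter_upwards [coeFn_lpCurve hn (dataToSchwartz d) s] with θ hθ
  rw [hθ, laxPhillips_eq_lpSchwartz]

/-- The transform is isometric and intertwines the evolution with a translation, which is isometric.
Conservation of energy thus needs no separate computation. -/
lemma isometry_waveOnData (hn : Odd n) (t : ℝ) : Isometry (waveOnData (n := n) t) :=
  Isometry.of_dist_eq fun d e => by
    rw [← (lpData hn).isometry.dist_eq, lpData_waveOnData, lpData_waveOnData,
      (isometry_translate t).dist_eq, (lpData hn).isometry.dist_eq]

/-- `Completion.map` extends a map only if it is uniformly continuous; the isometry property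
supplies this. -/
lemma waveGroup_coe (hn : Odd n) (t : ℝ) (d : Data n) :
    waveGroup t (d : EnergySpace n) = (waveOnData t d : EnergySpace n) :=
  Completion.map_coe (isometry_waveOnData hn t).uniformContinuous d

end Translation

/-! ### Extension to the energy space -/

section Unitary

variable {n : ℕ}

/-- The Lax–Phillips transform as a unitary map on the energy space. -/
def lpUnitary (hn : Odd n) : EnergySpace n ≃ₗᵢ[ℂ] TransL2 n :=
  (LinearEquiv.refl ℂ (Data n)).extendOfIsometry
    (Completion.toComplₗᵢ (𝕜 := ℂ) (E := Data n)).toLinearMap (lpData hn).toLinearMap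
    Completion.denseRange_coe (dense_range_lpTransform hn)
    fun d => ((lpData hn).norm_map d).trans (Completion.norm_coe d).symm

lemma lpUnitary_coe (hn : Odd n) (d : Data n) : lpUnitary hn (d : EnergySpace n) = lpData hn d :=
  LinearEquiv.extendOfIsometry_eq (LinearEquiv.refl ℂ (Data n))
    (Completion.toComplₗᵢ (𝕜 := ℂ) (E := Data n)).toLinearMap (lpData hn).toLinearMap _ _ _ d

/-- Both sides are continuous in `x` and agree on the dense set of test data. -/
lemma lpUnitary_waveGroup (hn : Odd n) (t : ℝ) (x : EnergySpace n) :
    lpUnitary hn (waveGroup t x) = translate t (lpUnitary hn x) := by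
  refine Completion.induction_on x ?_ fun d => ?_
  · exact isClosed_eq ((lpUnitary hn).continuous.comp Completion.continuous_map)
      ((isometry_translate t).continuous.comp (lpUnitary hn).continuous)
  · rw [waveGroup_coe hn, lpUnitary_coe, lpUnitary_coe, lpData_waveOnData]

end Unitary

end LaxPhillips

end

theorem mainTheorem1 (n : ℕ) (hn : Odd n) :
    -- the free wave group is well defined by the Cauchy problem
    (∀ d : Data n,
      ∃! u : ℝ → Space n → ℂ,
        IsFreeWave u ∧ HasCauchyData u 0 d) ∧
    (∀ (d : Data n) (u : ℝ → Space n → ℂ),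
      IsFreeWave u → HasCauchyData u 0 d →
      ∀ t : ℝ, ∃ d' : Data n, HasCauchyData u t d' ∧
        waveGroup t (d : EnergySpace n) =
          (d' : EnergySpace n)) ∧
    -- the transform extends to a unitary isomorphism which is a translation representation
    ∃ L : EnergySpace n ≃ₗᵢ[ℂ] TransL2 n,
      (∀ d : Data n, ∀ᵐ s : ℝ,
        (L (d : EnergySpace n) s : Sph n → ℂ)
          =ᵐ[(volume : Measure (Space n)).toSphere]
            laxPhillips d s) ∧
      (∀ (t : ℝ) (x : EnergySpace n),
        (L (waveGroup t x) : ℝ → SphL2 n)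
          =ᵐ[volume] fun s => L x (s - t)) := by
  refine ⟨fun d => ?_, fun d u hu hu0 t => ?_, ?_⟩
  · exact ⟨freeWave d, ⟨isFreeWave_freeWave d, hasCauchyData_freeWave d⟩,
      fun v hv => hv.1.unique (isFreeWave_freeWave d) hv.2 (hasCauchyData_freeWave d)⟩
  · obtain rfl := hu.unique (isFreeWave_freeWave d) hu0 (hasCauchyData_freeWave d)
    exact ⟨waveOnData t d, hasCauchyData_waveOnData t d, waveGroup_coe hn t d⟩
  · refine ⟨lpUnitary hn, fun d => ?_, fun t x => ?_⟩
    · rw [lpUnitary_coe]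
      exact coeFn_lpData hn d
    · rw [lpUnitary_waveGroup]
      exact coeFn_translate t _
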